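/- Let $m,Q\in\mathbb R$ and consider the Reissner–Nordström 3-metric $$ds^2=f(r)\,dr^2+r^2(d\theta^2+\sin^2\theta\,d\phi^2),\qquad f(r)=\Bigl(1-\frac{2m}{r}+\frac{Q^2}{r^2}\Bigr)^{-1},$$ where $r$ ranges over all $r>0$ if $m^2<Q^2$, and over all $r>0$ with $r>r_0=m+\sqrt{m^2-Q^2}$ if $m^2\ge Q^2$. For $|Q|<m$ the horizon $r=r_0$ is included as a sphere by passing to the coordinate $s$ with $r=m+\sqrt{m^2-Q^2}\cosh s$, in which the metric is $r(s)^2(ds^2+d\Omega^2)$ and is regular at $s=0$. A sphere $\Sigma=\{r=\text{const}\}$ is called isoperimetric if its area is stationary under smooth variations through nearby graphs over it that enclose the same volume. For a smooth function $\alpha$ on $\Sigma$ with $\int_\Sigma\alpha\,dA=0$ let $$F(\alpha)=\int_\Sigma\bigl[-\alpha\Delta_\Sigma\alpha-\alpha^2(\chi_{AB}\chi^{AB}+R_{ab}n^an^b)\bigr]dA,$$ where $\chi_{AB}$ is the second fundamental form, $n^a$ the unit normal and $R_{ab}$ the Ricci tensor of the 3-metric. An isoperimetric sphere is stable if $F(\alpha)>0$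 for all such $\alpha\not\equiv0$, and weakly stable if $F(\alpha)\ge0$ for all such $\alpha$; a sphere is unstable if $F(\alpha)<0$ for some such $\alpha$. Let $A$ denote the area of the sphere. Then: 0. Every sphere $r=\text{const}$ has constant mean curvature $2/(r\sqrt f)$ (which is $0$ at the horizon) and is isoperimetric, and $F$ is its second variation of area: along every volume-preserving variation with normal speed $\alpha$ the area is twice differentiable at the initial time with second derivative $F(\alpha)$, and every smooth $\alpha$ of zero mean is the normal speed of such a variation. 1. If $0\le|Q|\le m$, all the spheres (including the horizon if $|Q|<m$) are weakly stable, and they are stable if $m>0$. 2. If $m<0$, all the spheres are isoperimetric but unstable. 3. If $0<m<|Q|$, put $r_c=\frac{2Q^2}{3m}$. The sphere of radius $r$ is stable if and only if $r>r_c$, and unstable if and only if $r<r_c$. 4. For all $m,Q$, every stable, and even every weakly stable, isoperimetric sphere satisfies $A\ge\frac{16}{9}\pi Q^2$, and none of these spheres attains equality. The area of the sphere $r=r_c$ satisfies $A/Q^2\to\frac{16}{9}\pi$ as $Q^2/m^2\to1^+$ with $m>0$; in particular $A\to\frac{16}{9}\pi Q^2$ as $m\to|Q|^-$ with $Q\ne0$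 fixed. Conversely, if a sequence of weakly stable spheres $r=r_n$ with $r_n$ in the above range, with parameters $m_n$ and $Q_n\neq0$, has $A_n/Q_n^2\to\frac{16}{9}\pi$, then $0<m_n<|Q_n|$ for all large $n$, $Q_n^2/m_n^2\to1$, and $r_n/r_{c,n}\to1$ with $r_{c,n}=\frac{2Q_n^2}{3m_n}$. -/

import Mathlib

open Real Set Filter Topology
open scoped ContDiff

noncomputable section

namespace RN

/-! ### Riemannian geometry in a coordinate chart -/

/-- The `i`-th partial derivative of `F` at `x`. -/
def partialDeriv {n : ℕ} (i : Fin n) (F : (Fin n → ℝ) → ℝ) (x : Fin n → ℝ) : ℝ :=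
  deriv (fun t => F (Function.update x i t)) (x i)

/-- A field of symmetric matrices: the components `g_ij` of a metric in a chart of dimension `n`. -/
abbrev MetricField (n : ℕ) : Type := (Fin n → ℝ) → Matrix (Fin n) (Fin n) ℝ

/-- Christoffel symbols `Γ^k_ij` of the Levi-Civita connection. -/
def christoffel {n : ℕ} (g : MetricField n) (k i j : Fin n) (x : Fin n → ℝ) : ℝ :=
  (1 / 2) * ∑ l, (g x)⁻¹ k l *
    (partialDeriv i (fun z => g z j l) x + partialDeriv j (fun z => g z i l) x
      - partialDeriv l (fun z => g z i j) x)

/-- Ricci tensor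
`R_ij = ∂_k Γ^k_ij - ∂_j Γ^k_ik + Γ^k_kl Γ^l_ij - Γ^k_jl Γ^l_ik`. -/
def ricci {n : ℕ} (g : MetricField n) (i j : Fin n) (x : Fin n → ℝ) : ℝ :=
  (∑ k, (partialDeriv k (christoffel g k i j) x - partialDeriv j (christoffel g k i k) x))
    + ∑ k, ∑ l, (christoffel g k k l x * christoffel g l i j x
        - christoffel g k j l x * christoffel g l i k x)

/-- Laplace–Beltrami operator `(√det γ)⁻¹ ∂_A (√det γ γ^{AB} ∂_B a)`. -/
def laplaceBeltrami {n : ℕ} (γ : MetricField n) (a : (Fin n → ℝ) → ℝ) (y : Fin n → ℝ) : ℝ :=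
  (√((γ y).det))⁻¹ * ∑ A, partialDeriv A
    (fun z => √((γ z).det) * ∑ B, (γ z)⁻¹ A B * partialDeriv B a z) y

/-! ### Surfaces that are graphs over the unit sphere

The chart of the three-manifold is `(x, θ, φ)` with `0 < θ < π` and `0 < φ < 2π`; it omits only a
set of measure zero of each sphere. -/

/-- The point of the unit sphere of `ℝ³` with spherical coordinates `y = (θ, φ)`. -/
def spherePoint (y : Fin 2 → ℝ) : Fin 3 → ℝ :=
  ![sin (y 0) * cos (y 1), sin (y 0) * sin (y 1), cos (y 0)]

/-- Parametrization of the graph `x = u(ω)`, `ω` in the unit sphere.  Smooth functions on the unit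
sphere are represented by smooth functions on `ℝ³`, of which only the restriction to the sphere
matters (every smooth function on the sphere is such a restriction). -/
def graphMap (u : (Fin 3 → ℝ) → ℝ) (y : Fin 2 → ℝ) : Fin 3 → ℝ :=
  ![u (spherePoint y), y 0, y 1]

/-- The first fundamental form of a parametrized surface `X`. -/
def inducedMetric (g : MetricField 3) (X : (Fin 2 → ℝ) → (Fin 3 → ℝ)) : MetricField 2 :=
  fun y => Matrix.of fun A B => ∑ a, ∑ b,
    g (X y) a b * partialDeriv A (fun z => X z a) y * partialDeriv B (fun z => X z b) y

/-- Integral over the coordinate domain `0 < θ < π`, `0 < φ < 2π`. -/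
def angularIntegral (h : (Fin 2 → ℝ) → ℝ) : ℝ :=
  ∫ θ in (0 : ℝ)..π, ∫ φ in (0 : ℝ)..(2 * π), h ![θ, φ]

/-- The area of the graph `x = u(ω)`. -/
def graphArea (g : MetricField 3) (u : (Fin 3 → ℝ) → ℝ) : ℝ :=
  angularIntegral fun y => √((inducedMetric g (graphMap u) y).det)

/-- The signed volume between the coordinate sphere `x = c` and the graph `x = u(ω)`. -/
def volumeBetween (g : MetricField 3) (c : ℝ) (u : (Fin 3 → ℝ) → ℝ) : ℝ :=
  angularIntegral fun y =>
    ∫ x in c..(u (spherePoint y)), √((g ![x, y 0, y 1]).det)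

/-! ### Geometry of the coordinate spheres `x = c` -/

/-- The first fundamental form of the coordinate sphere `x = c`. -/
def sphereMetric (g : MetricField 3) (c : ℝ) : MetricField 2 :=
  inducedMetric g (graphMap fun _ => c)

/-- Area of the coordinate sphere `x = c`. -/
def sphereArea (g : MetricField 3) (c : ℝ) : ℝ := graphArea g fun _ => c

/-- Unit conormal `n_a` of the level sets of the first coordinate `x`, pointing to increasing
`x`. -/
def conormal (g : MetricField 3) (a : Fin 3) (x : Fin 3 → ℝ) : ℝ :=
  if a = 0 then (√((g x)⁻¹ 0 0))⁻¹ else 0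

/-- Unit normal vector `n^a = g^{ab} n_b`. -/
def unitNormal (g : MetricField 3) (a : Fin 3) (x : Fin 3 → ℝ) : ℝ :=
  ∑ b, (g x)⁻¹ a b * conormal g b x

/-- The covariant derivative `∇_a n_b` of the unit conormal. -/
def covDerivConormal (g : MetricField 3) (a b : Fin 3) (x : Fin 3 → ℝ) : ℝ :=
  partialDeriv a (conormal g b) x - ∑ d, christoffel g d a b x * conormal g d x

/-- Second fundamental form `χ_AB = ∇_A n_B` of the sphere `x = c`, in the coordinates
`(θ, φ)`. -/
def secondFundamentalForm (g : MetricField 3) (c : ℝ) (A B : Fin 2) (y : Fin 2 → ℝ) : ℝ :=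
  covDerivConormal g A.succ B.succ ![c, y 0, y 1]

/-- Mean curvature `γ^{AB} χ_AB` of the sphere `x = c`. -/
def meanCurvature (g : MetricField 3) (c : ℝ) (y : Fin 2 → ℝ) : ℝ :=
  ∑ A, ∑ B, (sphereMetric g c y)⁻¹ A B * secondFundamentalForm g c A B y

/-- `χ_AB χ^AB`. -/
def secondFundamentalFormNormSq (g : MetricField 3) (c : ℝ) (y : Fin 2 → ℝ) : ℝ :=
  ∑ A, ∑ B, ∑ C, ∑ D, (sphereMetric g c y)⁻¹ A C * (sphereMetric g c y)⁻¹ B D *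
    secondFundamentalForm g c A B y * secondFundamentalForm g c C D y

/-- `R_ab n^a n^b` on the sphere `x = c`. -/
def ricciNormal (g : MetricField 3) (c : ℝ) (y : Fin 2 → ℝ) : ℝ :=
  ∑ a, ∑ b, ricci g a b ![c, y 0, y 1] *
    unitNormal g a ![c, y 0, y 1] * unitNormal g b ![c, y 0, y 1]

/-- The integral of `a` over the sphere `x = c` with respect to its area element. -/
def sphereIntegral (g : MetricField 3) (c : ℝ) (a : (Fin 2 → ℝ) → ℝ) : ℝ :=
  angularIntegral fun y => a y * √((sphereMetric g c y).det)

/-- The stability functional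
`F(α) = ∫ [-α Δα - α² (χ_AB χ^AB + R_ab n^a n^b)] dA` of the sphere `x = c`, where `α` is given as
a function of `(θ, φ)`. -/
def stabilityForm (g : MetricField 3) (c : ℝ) (a : (Fin 2 → ℝ) → ℝ) : ℝ :=
  sphereIntegral g c fun y =>
    - a y * laplaceBeltrami (sphereMetric g c) a y
      - a y ^ 2 * (secondFundamentalFormNormSq g c y + ricciNormal g c y)

/-- Admissible test functions: smooth, with zero mean over the sphere `x = c`. -/
def IsTestFunction (g : MetricField 3) (c : ℝ) (α : (Fin 3 → ℝ) → ℝ) : Prop :=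
  ContDiff ℝ ∞ α ∧ sphereIntegral g c (fun y => α (spherePoint y)) = 0

/-- `u t` is a smooth one-parameter family of graphs that starts at the sphere `x = c` and
encloses the same volume as that sphere for all small `t`. -/
structure IsVolumePreservingVariation (g : MetricField 3) (c : ℝ)
    (u : ℝ → (Fin 3 → ℝ) → ℝ) : Prop where
  smooth : ContDiff ℝ ∞ (fun p : ℝ × (Fin 3 → ℝ) => u p.1 p.2)
  initial : ∀ y, u 0 (spherePoint y) = c
  volume_eq : ∀ᶠ t in 𝓝 (0 : ℝ), volumeBetween g c (u t) = 0

/-- The normal component of the initial velocity of the variation `u` of the sphere `x = c`. -/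
def normalSpeed (g : MetricField 3) (c : ℝ) (u : ℝ → (Fin 3 → ℝ) → ℝ) (y : Fin 2 → ℝ) : ℝ :=
  conormal g 0 ![c, y 0, y 1] * deriv (fun t => u t (spherePoint y)) 0

/-- The sphere `x = c` is isoperimetric: its area is stationary among nearby surfaces that
enclose the same volume. -/
def IsIsoperimetric (g : MetricField 3) (c : ℝ) : Prop :=
  ∀ u, IsVolumePreservingVariation g c u → HasDerivAt (fun t => graphArea g (u t)) 0 0

/-- `F` is the second variation of area: for volume-preserving variations of the sphere `x = c`
the area is twice differentiable at `0` with second derivative `F` of the normal speed, and every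
admissible test function is the normal speed of such a variation. -/
def IsSecondVariation (g : MetricField 3) (c : ℝ) : Prop :=
  (∀ u, IsVolumePreservingVariation g c u →
    (∀ᶠ t in 𝓝 (0 : ℝ), DifferentiableAt ℝ (fun s => graphArea g (u s)) t) ∧
    HasDerivAt (deriv fun s => graphArea g (u s)) (stabilityForm g c (normalSpeed g c u)) 0) ∧
  (∀ α, IsTestFunction g c α → ∃ u, IsVolumePreservingVariation g c u ∧
    ∀ y : Fin 2 → ℝ, y 0 ∈ Ioo 0 π → normalSpeed g c u y = α (spherePoint y))

/-- Stable isoperimetric sphere: isoperimetric, and `F(α) > 0` for every admissible test function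
that does not vanish identically on the sphere. -/
def IsStable (g : MetricField 3) (c : ℝ) : Prop :=
  IsIsoperimetric g c ∧ ∀ α, IsTestFunction g c α → (∃ y, α (spherePoint y) ≠ 0) →
    0 < stabilityForm g c (fun y => α (spherePoint y))

/-- Weakly stable isoperimetric sphere: isoperimetric, and `F(α) ≥ 0` for every admissible test
function. -/
def IsWeaklyStable (g : MetricField 3) (c : ℝ) : Prop :=
  IsIsoperimetric g c ∧ ∀ α, IsTestFunction g c α →
    0 ≤ stabilityForm g c (fun y => α (spherePoint y))

/-- Unstable sphere: `F(α) < 0` for some admissible test function. -/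
def IsUnstable (g : MetricField 3) (c : ℝ) : Prop :=
  ∃ α, IsTestFunction g c α ∧ stabilityForm g c (fun y => α (spherePoint y)) < 0

/-! ### The Reissner–Nordström metric -/

/-- The metric `h(x) dx² + R(x)² (dθ² + sin² θ dφ²)` in the coordinates `(x, θ, φ)`. -/
def sphericalMetric (h R : ℝ → ℝ) : MetricField 3 := fun x =>
  Matrix.diagonal ![h (x 0), R (x 0) ^ 2, R (x 0) ^ 2 * sin (x 1) ^ 2]

/-- `f(r) = (1 - 2m/r + Q²/r²)⁻¹`. -/
def rnF (m Q r : ℝ) : ℝ := (1 - 2 * m / r + Q ^ 2 / r ^ 2)⁻¹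

/-- The Reissner–Nordström metric `f(r) dr² + r² dΩ²` in the coordinates `(r, θ, φ)`. -/
def rnMetric (m Q : ℝ) : MetricField 3 := sphericalMetric (rnF m Q) (fun r => r)

/-- The range of the coordinate `r`: all `r > 0` in the super-extreme case `m² < Q²`, and all
`r > 0` with `r > m + √(m² - Q²)` otherwise. -/
def rnRange (m Q : ℝ) : Set ℝ := {r | 0 < r ∧ (Q ^ 2 ≤ m ^ 2 → m + √(m ^ 2 - Q ^ 2) < r)}

/-- The critical radius `r_c = 2Q²/(3m)`. -/
def rnCritical (m Q : ℝ) : ℝ := 2 * Q ^ 2 / (3 * m)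

/-- The radius `r` as a function of the coordinate `s` with `r = m + √(m² - Q²) cosh s`. -/
def horizonRadius (m Q s : ℝ) : ℝ := m + √(m ^ 2 - Q ^ 2) * cosh s

/-- For `|Q| < m`, the Reissner–Nordström metric in the coordinate `s`, in which it reads
`r(s)² (ds² + dΩ²)` and is regular at the horizon `s = 0`, where `r = m + √(m² - Q²)`. -/
def rnHorizonMetric (m Q : ℝ) : MetricField 3 :=
  sphericalMetric (fun s => horizonRadius m Q s ^ 2) (horizonRadius m Q)

end RN

end

/-! For a metric h dx² + R² dΩ² the stability of a coordinate sphere depends on one number. The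
quantity K = R²(χ_AB χ^AB + R_ab n^a n^b) is constant on the sphere (`stabilityConst`), and
integration by parts gives F(β) = E(β) − K N(β), where E and N are the Dirichlet energy and the
squared L² norm on the unit sphere (`stabilityForm_sphericalMetric`). On functions of zero mean 2N ≤
E (`sphere_poincare`), with equality for the height function. Hence the sphere is stable, weakly
stable or unstable according as K < 2, K ≤ 2 or K > 2.

The Poincaré inequality is proved without spherical harmonics. At each latitude f is split into its
φ-mean and a fluctuation. Wirtinger's inequality controls the fluctuation, a one-dimensional
inequality controls the mean, and both rest on completed squares that vanish on the first harmonics.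

The variational statements use a Lagrange multiplier. With V the primitive of the volume density and
λ the mean curvature, the area along a volume-preserving family equals ∫ (G(u) + e |∇u|²) for G = R²
− λV and a smooth coefficient e. The choice of λ makes c critical for G, so the first derivative
vanishes and the second involves only the initial velocity (`exists_second_variation`). Conversely,
a zero-mean α is realised by making V(u_t) linear in t.

For Reissner–Nordström K = 2 − 6m/r + 4Q²/r², so stability means 2Q² < 3mr. If m < |Q|, weak
stability gives r ≥ 2Q²/(3m) > 2|Q|/3; if |Q| ≤ m, the range of r gives r > m ≥ |Q|. At the horizon
R' = 0 and R'' > 0, so K < 0. The sharpness statements follow by squeezing the same inequalities. -/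

noncomputable section

namespace RN

open MeasureTheory

/-! ### Integrals depending on a parameter -/

/-- Differentiation under the integral sign for jointly continuous data. -/
theorem hasDerivAt_intervalIntegral_of_continuous {F F' : ℝ → ℝ → ℝ}
    (hF : Continuous (Function.uncurry F)) (hF' : Continuous (Function.uncurry F'))
    (h : ∀ t x, HasDerivAt (fun s => F s x) (F' t x) t) (a b t : ℝ) :
    HasDerivAt (fun s => ∫ x in a..b, F s x) (∫ x in a..b, F' t x) t := by
  obtain ⟨C, hC⟩ := (((isCompact_closedBall t 1).prod
    (isCompact_uIcc (a := a) (b := b))).exists_bound_of_continuousOn hF'.continuousOn)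
  refine (intervalIntegral.hasDerivAt_integral_of_dominated_loc_of_deriv_le
    (F := F) (F' := F') (bound := fun _ => C) (Metric.closedBall_mem_nhds t one_pos)
    ?_ ?_ ?_ ?_ ?_ ?_).2
  · exact Eventually.of_forall fun s => (hF.uncurry_left s).aestronglyMeasurable
  · exact (hF.uncurry_left t).intervalIntegrable _ _
  · exact (hF'.uncurry_left t).aestronglyMeasurable
  · exact Eventually.of_forall fun x hx s hs => hC (s, x) ⟨hs, uIoc_subset_uIcc hx⟩
  · exact intervalIntegrable_const
  · exact Eventually.of_forall fun x _ s _ => h s x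

theorem continuous_intervalIntegral_of_continuous {X : Type*} [TopologicalSpace X]
    {F : X → ℝ → ℝ} (hF : Continuous (Function.uncurry F)) (a b : ℝ) :
    Continuous fun s => ∫ x in a..b, F s x :=
  intervalIntegral.continuous_parametric_intervalIntegral_of_continuous' hF a b

/-- Differentiation under a double integral for jointly continuous data. -/
theorem hasDerivAt_integral_integral_of_continuous {F F' : ℝ → ℝ → ℝ → ℝ}
    (hF : Continuous fun p : ℝ × ℝ × ℝ => F p.1 p.2.1 p.2.2)
    (hF' : Continuous fun p : ℝ × ℝ × ℝ => F' p.1 p.2.1 p.2.2)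
    (h : ∀ t x y, HasDerivAt (fun s => F s x y) (F' t x y) t) (a b c d t : ℝ) :
    HasDerivAt (fun s => ∫ x in a..b, ∫ y in c..d, F s x y)
      (∫ x in a..b, ∫ y in c..d, F' t x y) t := by
  refine hasDerivAt_intervalIntegral_of_continuous
    (F := fun s x => ∫ y in c..d, F s x y) (F' := fun s x => ∫ y in c..d, F' s x y) ?_ ?_ ?_ a b t
  · exact continuous_intervalIntegral_of_continuous (X := ℝ × ℝ)
      (F := fun p y => F p.1 p.2 y)
      (hF.comp (by fun_prop : Continuous fun q : (ℝ × ℝ) × ℝ => (q.1.1, q.1.2, q.2))) c d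
  · exact continuous_intervalIntegral_of_continuous (X := ℝ × ℝ)
      (F := fun p y => F' p.1 p.2 y)
      (hF'.comp (by fun_prop : Continuous fun q : (ℝ × ℝ) × ℝ => (q.1.1, q.1.2, q.2))) c d
  · intro t x
    refine hasDerivAt_intervalIntegral_of_continuous
      (F := fun s y => F s x y) (F' := fun s y => F' s x y) ?_ ?_ (fun t y => h t x y) c d t
    · exact hF.comp (by fun_prop : Continuous fun q : ℝ × ℝ => (q.1, x, q.2))
    · exact hF'.comp (by fun_prop : Continuous fun q : ℝ × ℝ => (q.1, x, q.2))

/-! ### The Poincaré inequality on the sphere -/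

/-- Wirtinger's inequality on the circle. -/
theorem wirtinger {f f' : ℝ → ℝ} (hf : ∀ x, HasDerivAt f (f' x) x) (hf' : Continuous f')
    (hper : f (2 * π) = f 0) (hmean : ∫ x in (0 : ℝ)..(2 * π), f x = 0) :
    ∫ x in (0 : ℝ)..(2 * π), f x ^ 2 ≤ ∫ x in (0 : ℝ)..(2 * π), f' x ^ 2 := by
  have h2π : (0 : ℝ) < 2 * π := by positivity
  have hfc : Continuous f := continuous_iff_continuousAt.2 fun x => (hf x).continuousAt
  have hL2 : ∀ {g : ℝ → ℝ}, Continuous g →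
      MemLp (fun x => (g x : ℂ)) 2 (volume.restrict (Ioc 0 (2 * π))) := by
    intro g hg
    obtain ⟨C, hC⟩ := isCompact_Icc (a := (0 : ℝ)) (b := 2 * π) |>.exists_bound_of_continuousOn
      hg.continuousOn
    refine MemLp.of_bound (by fun_prop) C ?_
    filter_upwards [ae_restrict_mem measurableSet_Ioc] with x hx
    simpa using hC x (Ioc_subset_Icc_self hx)
  have h1 := hasSum_sq_fourierCoeffOn h2π (hL2 hfc)
  have h2 := hasSum_sq_fourierCoeffOn h2π (hL2 hf')
  -- Parseval reduces the claim to coefficients. Equal endpoint values give c_n(f) = c_n(f')/(in),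
  -- and |n| ≥ 1 for n ≠ 0; the zero mean disposes of n = 0.
  have key : ∀ n : ℤ, ‖fourierCoeffOn h2π (fun x => (f x : ℂ)) n‖ ^ 2
      ≤ ‖fourierCoeffOn h2π (fun x => (f' x : ℂ)) n‖ ^ 2 := by
    intro n
    rcases eq_or_ne n 0 with rfl | hn
    · have : fourierCoeffOn h2π (fun x => (f x : ℂ)) 0 = 0 := by
        rw [fourierCoeffOn_eq_integral]
        simp [intervalIntegral.integral_ofReal, hmean]
      rw [this]
      simp
    · have := fourierCoeffOn_of_hasDerivAt h2π (f := fun x => (f x : ℂ))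
        (f' := fun x => (f' x : ℂ)) hn (fun x _ => (hf x).ofReal_comp)
        (by apply Continuous.intervalIntegrable; fun_prop)
      rw [this, hper]
      gcongr
      simp only [sub_self, mul_zero, sub_zero, zero_sub, norm_mul, norm_neg, norm_div, norm_one,
        Complex.norm_I, Complex.norm_real, Complex.norm_ofNat, Complex.ofReal_zero,
        Complex.ofReal_mul, Complex.ofReal_ofNat, Complex.norm_intCast, Real.norm_eq_abs,
        abs_of_pos pi_pos, mul_one]
      have hn1 : (1 : ℝ) ≤ |(n : ℝ)| := by exact_mod_cast Int.one_le_abs hn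
      rw [← mul_assoc]
      refine mul_le_of_le_one_left (norm_nonneg _) ?_
      rw [div_mul_eq_mul_div, one_mul, mul_comm, div_le_one (by positivity)]
      nlinarith [pi_pos]
  have := hasSum_le key h1 h2
  simp only [sub_zero, Complex.norm_real, Real.norm_eq_abs, sq_abs, smul_eq_mul] at this
  exact le_of_mul_le_mul_left this (by positivity)

/-- The Poincaré inequality for zonal functions of zero mean. -/
theorem two_mul_integral_sq_mul_sin_le {m m' : ℝ → ℝ} (hm : ∀ x, HasDerivAt m (m' x) x)
    (hm' : Continuous m') (hmean : ∫ x in (0 : ℝ)..π, m x * sin x = 0) :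
    2 * ∫ x in (0 : ℝ)..π, m x ^ 2 * sin x ≤ ∫ x in (0 : ℝ)..π, m' x ^ 2 * sin x := by
  have hmc : Continuous m := continuous_iff_continuousAt.2 fun x => (hm x).continuousAt
  -- For the extremal function cos this is sin²/2. The zero mean makes `G` vanish at π as well as at
  -- 0.
  set G : ℝ → ℝ := fun x => ∫ t in (0 : ℝ)..x, m t * sin t with hG
  have hG' : ∀ x, HasDerivAt G (m x * sin x) x := fun x =>
    ((hmc.mul continuous_sin).integral_hasStrictDerivAt 0 x).hasDerivAt
  have hGc : Continuous G := continuous_iff_continuousAt.2 fun x => (hG' x).continuousAt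
  obtain ⟨M, hM⟩ := isCompact_Icc (a := (0 : ℝ)) (b := π) |>.exists_bound_of_continuousOn
    hmc.continuousOn
  have hM0 : 0 ≤ M := (norm_nonneg _).trans (hM 0 (by simp [pi_nonneg]))
  -- Integrating from the nearer pole bounds |G| by M(1 ∓ cos), which is at most M sin² on that
  -- half. So G / sin is continuous up to the poles with value 0, the value that division by zero
  -- assigns there.
  have hb1 : ∀ x ∈ Icc 0 π, |G x| ≤ M * (1 - cos x) := by
    intro x hx
    have h1 : ‖∫ t in (0 : ℝ)..x, m t * sin t‖ ≤ ∫ t in (0 : ℝ)..x, M * sin t := by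
      refine intervalIntegral.norm_integral_le_of_norm_le hx.1 ?_
        ((by fun_prop : Continuous fun t => M * sin t).intervalIntegrable _ _)
      refine Eventually.of_forall fun t ht => ?_
      have hs : 0 ≤ sin t := sin_nonneg_of_nonneg_of_le_pi ht.1.le (ht.2.trans hx.2)
      rw [norm_mul, Real.norm_eq_abs (sin t), abs_of_nonneg hs]
      exact mul_le_mul_of_nonneg_right (hM t ⟨ht.1.le, ht.2.trans hx.2⟩) hs
    simpa using h1
  have hb2 : ∀ x ∈ Icc 0 π, |G x| ≤ M * (1 + cos x) := by
    intro x hx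
    have h1 : ‖∫ t in x..π, m t * sin t‖ ≤ ∫ t in x..π, M * sin t := by
      refine intervalIntegral.norm_integral_le_of_norm_le hx.2 ?_
        ((by fun_prop : Continuous fun t => M * sin t).intervalIntegrable _ _)
      refine Eventually.of_forall fun t ht => ?_
      have hs : 0 ≤ sin t := sin_nonneg_of_nonneg_of_le_pi (hx.1.trans ht.1.le) ht.2
      rw [norm_mul, Real.norm_eq_abs (sin t), abs_of_nonneg hs]
      exact mul_le_mul_of_nonneg_right (hM t ⟨hx.1.trans ht.1.le, ht.2⟩) hs
    have h2 : G x = -∫ t in x..π, m t * sin t := by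
      have := intervalIntegral.integral_add_adjacent_intervals
        ((hmc.mul continuous_sin).intervalIntegrable (μ := volume) 0 x)
        ((hmc.mul continuous_sin).intervalIntegrable (μ := volume) x π)
      simp only [Pi.mul_apply] at this
      rw [hmean] at this
      simp only [hG]; linarith
    rw [h2, abs_neg]
    simpa [add_comm] using h1
  -- A null Lagrangian: it vanishes at both poles, and m'² sin − 2m² sin − T' is a sum of two
  -- squares, both zero for m = cos.
  set T : ℝ → ℝ := fun x => 4 * cos x * (G x / sin x) ^ 2 - 4 * m x * G x with hT
  have hq : ∀ x ∈ Icc 0 π, |G x / sin x| ≤ M * sin x := by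
    intro x hx
    have hs : 0 ≤ sin x := sin_nonneg_of_nonneg_of_le_pi hx.1 hx.2
    rcases hs.eq_or_lt with h0 | h0
    · rw [← h0]; simp
    · rw [abs_div, abs_of_pos h0, div_le_iff₀ h0]
      have := sin_sq_add_cos_sq x
      rcases le_total 0 (cos x) with hc | hc
      · refine (hb1 x hx).trans ?_
        rw [mul_assoc]
        exact mul_le_mul_of_nonneg_left (by nlinarith [cos_le_one x]) hM0
      · refine (hb2 x hx).trans ?_
        rw [mul_assoc]
        exact mul_le_mul_of_nonneg_left (by nlinarith [neg_one_le_cos x]) hM0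
  have hqc : ContinuousOn (fun x => G x / sin x) (Icc 0 π) := by
    intro x hx
    have hs : 0 ≤ sin x := sin_nonneg_of_nonneg_of_le_pi hx.1 hx.2
    rcases hs.eq_or_lt with h0 | h0
    · have hlim : Tendsto (fun x => M * sin x) (𝓝[Icc 0 π] x) (𝓝 0) := by
        have : Continuous fun x => M * sin x := by fun_prop
        have := (this.tendsto x).mono_left (nhdsWithin_le_nhds (s := Icc 0 π))
        rwa [← h0, mul_zero] at this
      rw [ContinuousWithinAt, ← h0, div_zero]
      exact squeeze_zero_norm' (by filter_upwards [self_mem_nhdsWithin] with y hy using hq y hy)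
        hlim
    · exact (hGc.continuousAt.div continuous_sin.continuousAt h0.ne').continuousWithinAt
  -- This comparison needs T' only in the open interval, so the integrability of its formula,
  -- singular at the poles, never has to be shown.
  have hmain := intervalIntegral.sub_le_integral_of_hasDeriv_right_of_le (g := T)
    (g' := fun x => -4 * sin x * (G x / sin x) ^ 2 + 4 * cos x * (2 * (G x / sin x) *
      ((m x * sin x * sin x - G x * cos x) / sin x ^ 2)) - (4 * m' x * G x + 4 * m x * (m x * sin x)))
    (φ := fun x => m' x ^ 2 * sin x - 2 * (m x ^ 2 * sin x)) pi_nonneg ?_ ?_ ?_ ?_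
  · have h0 : T 0 = 0 := by simp [hT, hG]
    have h1 : T π = 0 := by
      have : G π = 0 := hmean
      simp [hT, this]
    rw [h0, h1, intervalIntegral.integral_sub, intervalIntegral.integral_const_mul] at hmain
    · linarith
    all_goals apply Continuous.intervalIntegrable; fun_prop
  · exact ((by fun_prop : Continuous fun x => 4 * cos x).continuousOn.mul (hqc.pow 2)).sub
      (by fun_prop : Continuous fun x => 4 * m x * G x).continuousOn
  · intro x hx
    have h0 : sin x ≠ 0 := (sin_pos_of_mem_Ioo hx).ne'
    refine HasDerivAt.hasDerivWithinAt ?_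
    refine ((((hasDerivAt_cos x).const_mul 4).mul (((hG' x).div (hasDerivAt_sin x) h0).pow 2)).sub
      (((hm x).const_mul 4).mul (hG' x))).congr_deriv ?_
    simp only [Pi.div_apply, Pi.pow_apply]
    push_cast
    ring
  · exact (by fun_prop : Continuous fun x => m' x ^ 2 * sin x - 2 * (m x ^ 2 * sin x)).integrableOn_Icc
  · intro x hx
    have h0 : 0 < sin x := sin_pos_of_mem_Ioo hx
    have hcs := sin_sq_add_cos_sq x
    have e : m' x ^ 2 * sin x - 2 * (m x ^ 2 * sin x) - (-4 * sin x * (G x / sin x) ^ 2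
        + 4 * cos x * (2 * (G x / sin x) * ((m x * sin x * sin x - G x * cos x) / sin x ^ 2))
        - (4 * m' x * G x + 4 * m x * (m x * sin x)))
        = sin x * (m' x + 2 * (G x / sin x)) ^ 2
          + 2 * sin x * (m x - 2 * cos x * (G x / sin x) / sin x) ^ 2 := by
      field_simp
      ring
    have : 0 ≤ sin x * (m' x + 2 * (G x / sin x)) ^ 2
          + 2 * sin x * (m x - 2 * cos x * (G x / sin x) / sin x) ^ 2 := by positivity
    linarith

/-- The sharp Poincaré inequality on the unit sphere in spherical coordinates: `p` and `q` are the
components of the gradient of `f` in the orthonormal frame `(∂_θ, (sin θ)⁻¹ ∂_φ)`. -/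
theorem sphere_poincare {f p q : ℝ → ℝ → ℝ} (hf : Continuous (Function.uncurry f))
    (hp : Continuous (Function.uncurry p)) (hq : Continuous (Function.uncurry q))
    (hfp : ∀ θ φ, HasDerivAt (fun s => f s φ) (p θ φ) θ)
    (hfq : ∀ θ φ, HasDerivAt (f θ) (sin θ * q θ φ) φ)
    (hper : ∀ θ, f θ (2 * π) = f θ 0)
    (hmean : ∫ θ in (0 : ℝ)..π, ∫ φ in (0 : ℝ)..(2 * π), f θ φ * sin θ = 0) :
    2 * ∫ θ in (0 : ℝ)..π, ∫ φ in (0 : ℝ)..(2 * π), f θ φ ^ 2 * sin θ ≤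
      ∫ θ in (0 : ℝ)..π, ∫ φ in (0 : ℝ)..(2 * π), (p θ φ ^ 2 + q θ φ ^ 2) * sin θ := by
  have hint : ∀ {g : ℝ → ℝ → ℝ}, Continuous (Function.uncurry g) → ∀ θ,
      IntervalIntegrable (g θ) volume 0 (2 * π) := fun hg θ =>
    (hg.uncurry_left θ).intervalIntegrable _ _
  have hcont : ∀ {g : ℝ → ℝ → ℝ}, Continuous (Function.uncurry g) →
      Continuous fun θ => ∫ φ in (0 : ℝ)..(2 * π), g θ φ := fun hg =>
    continuous_intervalIntegral_of_continuous hg _ _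
  have cmul : ∀ {g h : ℝ → ℝ → ℝ}, Continuous (Function.uncurry g) →
      Continuous (Function.uncurry h) → Continuous (Function.uncurry fun θ φ => g θ φ * h θ φ) :=
    fun hg hh => hg.mul hh
  have csq : ∀ {g : ℝ → ℝ → ℝ}, Continuous (Function.uncurry g) →
      Continuous (Function.uncurry fun θ φ => g θ φ ^ 2) := fun hg => hg.pow 2
  set m : ℝ → ℝ := fun θ => ∫ φ in (0 : ℝ)..(2 * π), f θ φ with hm_def
  set m' : ℝ → ℝ := fun θ => ∫ φ in (0 : ℝ)..(2 * π), p θ φ with hm'_def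
  set S : ℝ → ℝ := fun θ => ∫ φ in (0 : ℝ)..(2 * π), f θ φ ^ 2 with hS_def
  set C : ℝ → ℝ := fun θ => ∫ φ in (0 : ℝ)..(2 * π), f θ φ * p θ φ with hC_def
  set P : ℝ → ℝ := fun θ => ∫ φ in (0 : ℝ)..(2 * π), p θ φ ^ 2 with hP_def
  set Z : ℝ → ℝ := fun θ => ∫ φ in (0 : ℝ)..(2 * π), q θ φ ^ 2 with hZ_def
  have hmc : Continuous m := hcont hf
  have hm'c : Continuous m' := hcont hp
  have hSc : Continuous S := hcont (csq hf)
  have hCc : Continuous C := hcont (cmul hf hp)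
  have hPc : Continuous P := hcont (csq hp)
  have hZc : Continuous Z := hcont (csq hq)
  have hm : ∀ θ, HasDerivAt m (m' θ) θ :=
    hasDerivAt_intervalIntegral_of_continuous hf hp hfp _ _
  have hS : ∀ θ, HasDerivAt S (2 * C θ) θ := by
    intro θ
    have := hasDerivAt_intervalIntegral_of_continuous (F := fun θ φ => f θ φ ^ 2)
      (F' := fun θ φ => 2 * (f θ φ * p θ φ)) (csq hf)
      (cmul (g := fun _ _ => 2) continuous_const (cmul hf hp))
      (fun θ φ => ((hfp θ φ).pow 2).congr_deriv (by push_cast; ring)) 0 (2 * π) θ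
    rwa [intervalIntegral.integral_const_mul] at this
  have hπ : (0 : ℝ) < 2 * π := by positivity
  -- Second moments of the fluctuations of p and f about their φ-means. Two cases are used: (a, b) =
  -- (0, 1), the variance of f, and (sin θ, −cos θ), a square that vanishes on the harmonics sin θ
  -- cos φ and sin θ sin φ.
  have hvar : ∀ θ (a b : ℝ), ∫ φ in (0 : ℝ)..(2 * π), (a * (p θ φ - m' θ / (2 * π))
      + b * (f θ φ - m θ / (2 * π))) ^ 2
      = a ^ 2 * (P θ - m' θ ^ 2 / (2 * π)) + 2 * a * b * (C θ - m θ * m' θ / (2 * π))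
        + b ^ 2 * (S θ - m θ ^ 2 / (2 * π)) := by
    intro θ a b
    have e : ∀ φ, (a * (p θ φ - m' θ / (2 * π)) + b * (f θ φ - m θ / (2 * π))) ^ 2
        = a ^ 2 * p θ φ ^ 2 + 2 * a * b * (f θ φ * p θ φ) + b ^ 2 * f θ φ ^ 2
          - 2 * a * ((a * m' θ + b * m θ) / (2 * π)) * p θ φ
          - 2 * b * ((a * m' θ + b * m θ) / (2 * π)) * f θ φ
          + ((a * m' θ + b * m θ) / (2 * π)) ^ 2 := by intro φ; ring
    simp_rw [e]
    have i1 := (hint (csq hp) θ).const_mul (a ^ 2)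
    have i2 := (hint (cmul hf hp) θ).const_mul (2 * a * b)
    have i3 := (hint (csq hf) θ).const_mul (b ^ 2)
    have i4 := (hint hp θ).const_mul (2 * a * ((a * m' θ + b * m θ) / (2 * π)))
    have i5 := (hint hf θ).const_mul (2 * b * ((a * m' θ + b * m θ) / (2 * π)))
    rw [intervalIntegral.integral_add ((((i1.add i2).add i3).sub i4).sub i5) (by simp),
      intervalIntegral.integral_sub (((i1.add i2).add i3).sub i4) i5,
      intervalIntegral.integral_sub ((i1.add i2).add i3) i4,
      intervalIntegral.integral_add (i1.add i2) i3, intervalIntegral.integral_add i1 i2]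
    simp only [intervalIntegral.integral_const_mul, intervalIntegral.integral_const, smul_eq_mul]
    change a ^ 2 * P θ + 2 * a * b * C θ + b ^ 2 * S θ - _ * m' θ - _ * m θ + _ = _
    field_simp
    ring
  have hW : ∀ θ, S θ - m θ ^ 2 / (2 * π) ≤ sin θ ^ 2 * Z θ := by
    intro θ
    have h1 := wirtinger (f := fun φ => f θ φ - m θ / (2 * π)) (f' := fun φ => sin θ * q θ φ)
      (fun φ => (hfq θ φ).sub_const _) (continuous_const.mul (hq.uncurry_left θ))
      (by simp only [hper]) (by
        rw [intervalIntegral.integral_sub (hint hf θ) (by simp)]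
        simp only [intervalIntegral.integral_const, smul_eq_mul, sub_zero]
        rw [mul_div_cancel₀ _ hπ.ne']
        exact sub_self _)
    have h2 := hvar θ 0 1
    simp only [zero_mul, zero_add, one_mul] at h2
    rw [h2] at h1
    simp only [mul_pow, intervalIntegral.integral_const_mul] at h1
    change _ ≤ sin θ ^ 2 * Z θ at h1
    linarith
  -- Expand the square for (sin θ, −cos θ), write cos² = 1 − sin², bound the remaining variance by
  -- `hW`, and divide by sin θ.
  have hpt : ∀ θ ∈ Ioo 0 π, m' θ ^ 2 / (2 * π) * sin θ
      + (cos θ * (2 * C θ - m θ * m' θ / π) + sin θ * (S θ - m θ ^ 2 / (2 * π)))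
      ≤ (P θ + Z θ) * sin θ := by
    intro θ hθ
    have h0 : 0 < sin θ := sin_pos_of_mem_Ioo hθ
    have h1 := hvar θ (sin θ) (-cos θ)
    have h2 : 0 ≤ ∫ φ in (0 : ℝ)..(2 * π), (sin θ * (p θ φ - m' θ / (2 * π))
      + (-cos θ) * (f θ φ - m θ / (2 * π))) ^ 2 :=
      intervalIntegral.integral_nonneg hπ.le fun φ _ => sq_nonneg _
    rw [h1] at h2
    have h3 := hW θ
    have h4 := cos_sq' θ
    refine le_of_mul_le_mul_left ?_ h0
    have e : m θ * m' θ / π = 2 * (m θ * m' θ / (2 * π)) := by field_simp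
    rw [e]
    have e2 : (-cos θ) ^ 2 = 1 - sin θ ^ 2 := by rw [neg_sq, h4]
    rw [e2] at h2
    nlinarith
  set B : ℝ → ℝ := fun θ => S θ - m θ ^ 2 / (2 * π) with hB_def
  have hBc : Continuous B := by fun_prop
  have hB : ∀ θ, HasDerivAt B (2 * C θ - m θ * m' θ / π) θ := by
    intro θ
    refine ((hS θ).sub (((hm θ).pow 2).div_const _)).congr_deriv ?_
    push_cast
    field_simp
  -- At a pole ∂_φ f = 0, so the variance vanishes and no boundary term survives.
  have hB0 : ∀ θ, sin θ = 0 → B θ = 0 := by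
    intro θ hθ
    have hconst : ∀ φ, f θ φ = f θ 0 := by
      have hd : ∀ φ, HasDerivAt (f θ) 0 φ := fun φ => by simpa [hθ] using hfq θ φ
      exact fun φ => is_const_of_deriv_eq_zero (fun x => (hd x).differentiableAt)
        (fun x => (hd x).deriv) φ 0
    simp only [hB_def, hS_def, hm_def]
    simp_rw [hconst, intervalIntegral.integral_const, smul_eq_mul]
    field_simp
    ring
  -- Integration by parts turns the cross term cos θ B' into a second copy of sin θ B; this produces
  -- the constant 2 for the fluctuation.
  have hcB : ∫ θ in (0 : ℝ)..π, (cos θ * (2 * C θ - m θ * m' θ / π) - sin θ * B θ) = 0 := by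
    rw [intervalIntegral.integral_eq_sub_of_hasDerivAt (f := fun θ => cos θ * B θ)]
    · rw [hB0 π sin_pi, hB0 0 sin_zero]; simp
    · intro θ _
      exact ((hasDerivAt_cos θ).mul (hB θ)).congr_deriv (by ring)
    · apply Continuous.intervalIntegrable; fun_prop
  have hzonal := two_mul_integral_sq_mul_sin_le hm hm'c (by
    simpa only [intervalIntegral.integral_mul_const] using hmean)
  have hle := intervalIntegral.integral_mono_on_of_le_Ioo (μ := volume) pi_nonneg
    (by apply Continuous.intervalIntegrable; fun_prop)
    (by apply Continuous.intervalIntegrable; fun_prop) hpt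
  have eL : ∀ θ, m' θ ^ 2 / (2 * π) * sin θ + (cos θ * (2 * C θ - m θ * m' θ / π) + sin θ * B θ)
      = (2 * π)⁻¹ * (m' θ ^ 2 * sin θ) + (cos θ * (2 * C θ - m θ * m' θ / π) - sin θ * B θ)
        + 2 * (S θ * sin θ) - 2 * (2 * π)⁻¹ * (m θ ^ 2 * sin θ) := by
    intro θ; simp only [hB_def]; field_simp; ring
  change ∫ θ in (0 : ℝ)..π, (m' θ ^ 2 / (2 * π) * sin θ
    + (cos θ * (2 * C θ - m θ * m' θ / π) + sin θ * B θ)) ≤ _ at hle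
  simp_rw [eL] at hle
  rw [intervalIntegral.integral_sub, intervalIntegral.integral_add, intervalIntegral.integral_add,
    hcB] at hle
  · simp only [intervalIntegral.integral_const_mul] at hle
    have e1 : ∀ θ, ∫ φ in (0 : ℝ)..(2 * π), f θ φ ^ 2 * sin θ = S θ * sin θ := fun θ => by
      rw [intervalIntegral.integral_mul_const]
    have e2 : ∀ θ, ∫ φ in (0 : ℝ)..(2 * π), (p θ φ ^ 2 + q θ φ ^ 2) * sin θ
        = (P θ + Z θ) * sin θ := fun θ => by
      rw [intervalIntegral.integral_mul_const,
        intervalIntegral.integral_add (hint (csq hp) θ) (hint (csq hq) θ)]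
    simp_rw [e1, e2]
    have : 0 < (2 * π)⁻¹ := by positivity
    nlinarith
  all_goals apply Continuous.intervalIntegrable; fun_prop

/-! ### Curvature of spherically symmetric metrics -/

/-- The coefficients `h` and `R` are smooth near `c` and positive at `c`. -/
structure IsRegularAt (h R : ℝ → ℝ) (c : ℝ) : Prop where
  smooth_h : ∀ᶠ x in 𝓝 c, ContDiffAt ℝ ∞ h x
  smooth_R : ∀ᶠ x in 𝓝 c, ContDiffAt ℝ ∞ R x
  pos_h : 0 < h c
  pos_R : 0 < R c

theorem update_three_zero (x : Fin 3 → ℝ) (t : ℝ) : Function.update x 0 t = ![t, x 1, x 2] := by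
  ext i; fin_cases i <;> simp

theorem update_three_one (x : Fin 3 → ℝ) (t : ℝ) : Function.update x 1 t = ![x 0, t, x 2] := by
  ext i; fin_cases i <;> simp

theorem update_three_two (x : Fin 3 → ℝ) (t : ℝ) : Function.update x 2 t = ![x 0, x 1, t] := by
  ext i; fin_cases i <;> simp

theorem update_two_zero (y : Fin 2 → ℝ) (t : ℝ) : Function.update y 0 t = ![t, y 1] := by
  ext i; fin_cases i <;> simp

theorem update_two_one (y : Fin 2 → ℝ) (t : ℝ) : Function.update y 1 t = ![y 0, t] := by
  ext i; fin_cases i <;> simp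

theorem inv_diagonal_of_ne_zero {n : ℕ} {v : Fin n → ℝ} (hv : ∀ i, v i ≠ 0) :
    (Matrix.diagonal v)⁻¹ = Matrix.diagonal fun i => (v i)⁻¹ := by
  refine Matrix.inv_eq_left_inv ?_
  rw [Matrix.diagonal_mul_diagonal, ← Matrix.diagonal_one]
  congr 1
  ext i
  simp [hv i]

theorem sphericalMetric_inv {h R : ℝ → ℝ} {x : Fin 3 → ℝ} (hh : h (x 0) ≠ 0) (hR : R (x 0) ≠ 0)
    (hs : sin (x 1) ≠ 0) : (sphericalMetric h R x)⁻¹ =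
      Matrix.diagonal ![(h (x 0))⁻¹, (R (x 0) ^ 2)⁻¹, (R (x 0) ^ 2 * sin (x 1) ^ 2)⁻¹] := by
  rw [sphericalMetric, inv_diagonal_of_ne_zero]
  · congr 1
    ext i; fin_cases i <;> simp
  · intro i; fin_cases i <;> simp [hh, hR, hs]

/-- The partial derivatives `∂_i g_jj` of a spherically symmetric metric. -/
def sphericalMetricDeriv (h R : ℝ → ℝ) (x : Fin 3 → ℝ) : Fin 3 → Fin 3 → ℝ :=
  ![![deriv h (x 0), 2 * R (x 0) * deriv R (x 0), 2 * R (x 0) * deriv R (x 0) * sin (x 1) ^ 2],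
    ![0, 0, R (x 0) ^ 2 * (2 * sin (x 1) * cos (x 1))], ![0, 0, 0]]

theorem partialDeriv_sphericalMetric {h R : ℝ → ℝ} {x : Fin 3 → ℝ}
    (hR : DifferentiableAt ℝ R (x 0)) (i j l : Fin 3) :
    partialDeriv i (fun z => sphericalMetric h R z j l) x =
      if j = l then sphericalMetricDeriv h R x i j else 0 := by
  have h1 : deriv (fun t => R t ^ 2) (x 0) = 2 * R (x 0) * deriv R (x 0) := by
    refine (hR.hasDerivAt.pow 2).deriv.trans ?_; push_cast; ring
  have h2 : deriv (fun t => sin t ^ 2) (x 1) = 2 * sin (x 1) * cos (x 1) := by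
    refine ((hasDerivAt_sin (x 1)).pow 2).deriv.trans ?_; push_cast; ring
  by_cases hjl : j = l
  · subst hjl
    fin_cases i <;> fin_cases j <;>
      simp [partialDeriv, sphericalMetric, sphericalMetricDeriv, h1, h2]
  · simp [partialDeriv, sphericalMetric, hjl]

/-- The Christoffel symbols of a spherically symmetric metric. -/
def sphericalChristoffel (h R : ℝ → ℝ) (x : Fin 3 → ℝ) (k i j : Fin 3) : ℝ :=
  1 / 2 * (![(h (x 0))⁻¹, (R (x 0) ^ 2)⁻¹, (R (x 0) ^ 2 * sin (x 1) ^ 2)⁻¹] k *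
        ((if j = k then sphericalMetricDeriv h R x i j else 0)
          + (if i = k then sphericalMetricDeriv h R x j i else 0)
          - (if i = j then sphericalMetricDeriv h R x k i else 0)))

theorem christoffel_sphericalMetric {h R : ℝ → ℝ} {x : Fin 3 → ℝ}
    (hRd : DifferentiableAt ℝ R (x 0)) (hh : h (x 0) ≠ 0) (hR : R (x 0) ≠ 0)
    (hs : sin (x 1) ≠ 0) (k i j : Fin 3) :
    christoffel (sphericalMetric h R) k i j x =
      sphericalChristoffel h R x k i j := by
  rw [christoffel, sphericalChristoffel, Finset.sum_eq_single k]
  · rw [sphericalMetric_inv hh hR hs, Matrix.diagonal_apply_eq]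
    simp only [partialDeriv_sphericalMetric hRd]
  · intro l _ hl
    rw [sphericalMetric_inv hh hR hs, Matrix.diagonal_apply_ne' _ hl, zero_mul]
  · simp

theorem IsRegularAt.eventually {h R : ℝ → ℝ} {c : ℝ} (hr : IsRegularAt h R c) :
    ∀ᶠ x in 𝓝 c, ContDiffAt ℝ ∞ h x ∧ ContDiffAt ℝ ∞ R x ∧ 0 < h x ∧ 0 < R x := by
  filter_upwards [hr.smooth_h, hr.smooth_R,
    hr.smooth_h.self_of_nhds.continuousAt.eventually_const_lt hr.pos_h,
    hr.smooth_R.self_of_nhds.continuousAt.eventually_const_lt hr.pos_R] with x h1 h2 h3 h4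
  exact ⟨h1, h2, h3, h4⟩

theorem hasDerivAt_deriv_of_contDiffAt {f : ℝ → ℝ} {x : ℝ} (hf : ContDiffAt ℝ ∞ f x) :
    HasDerivAt f (deriv f x) x ∧ HasDerivAt (deriv f) (deriv (deriv f) x) x := by
  refine ⟨(hf.differentiableAt (by simp)).hasDerivAt, DifferentiableAt.hasDerivAt ?_⟩
  have : ContDiffAt ℝ 1 (deriv f) x :=
    (hf.fderiv_right (m := 1) (by norm_num; exact WithTop.coe_le_coe.2 le_top)).clm_apply contDiffAt_const
  exact this.differentiableAt (by simp)

/-- Only this component is needed, because the unit normal is radial. The k = 0 derivative terms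
cancel, Γ^k_00 = 0 for angular k, and Γ^k_0k = R'/R for both angular k. The Christoffel formulas are
first established near the point, since they get differentiated. -/
theorem ricci_zero_zero_sphericalMetric {h R : ℝ → ℝ} {x : Fin 3 → ℝ}
    (hr : IsRegularAt h R (x 0)) (hs : sin (x 1) ≠ 0) :
    ricci (sphericalMetric h R) 0 0 x = -2 * deriv (deriv R) (x 0) / R (x 0)
      + deriv h (x 0) * deriv R (x 0) / (h (x 0) * R (x 0)) := by
  have hΓ : ∀ᶠ t in 𝓝 (x 0), ∀ s, sin s ≠ 0 → ∀ k i j,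
      christoffel (sphericalMetric h R) k i j ![t, s, x 2] = sphericalChristoffel h R ![t, s, x 2] k i j := by
    filter_upwards [hr.eventually] with t ht s hs k i j
    exact christoffel_sphericalMetric (x := ![t, s, x 2]) (ht.2.1.differentiableAt (by simp))
      ht.2.2.1.ne' ht.2.2.2.ne' hs k i j
  have hx : ![x 0, x 1, x 2] = x := by ext i; fin_cases i <;> rfl
  have hΓx : ∀ k i j, christoffel (sphericalMetric h R) k i j x =
      sphericalChristoffel h R x k i j := fun k i j => by
    have := hΓ.self_of_nhds (x 1) hs k i j
    rw [hx] at this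
    exact this
  have hsin : ∀ᶠ s in 𝓝 (x 1), sin s ≠ 0 := continuous_sin.continuousAt.eventually_ne hs
  have d1 : partialDeriv 1 (christoffel (sphericalMetric h R) 1 0 0) x = 0 := by
    have : (fun t => christoffel (sphericalMetric h R) 1 0 0 (Function.update x 1 t))
        =ᶠ[𝓝 (x 1)] fun _ => 0 := by
      filter_upwards [hsin] with s hs
      rw [update_three_one, hΓ.self_of_nhds s hs]
      simp [sphericalChristoffel, sphericalMetricDeriv]
    rw [partialDeriv, this.deriv_eq, deriv_const]
  have d2 : partialDeriv 2 (christoffel (sphericalMetric h R) 2 0 0) x = 0 := by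
    have : (fun t => christoffel (sphericalMetric h R) 2 0 0 (Function.update x 2 t))
        = fun _ => 0 := by
      ext t
      rw [update_three_two, christoffel_sphericalMetric (x := ![x 0, x 1, t])
        (hr.smooth_R.self_of_nhds.differentiableAt (by simp)) hr.pos_h.ne' hr.pos_R.ne' hs]
      simp [sphericalChristoffel, sphericalMetricDeriv]
    rw [partialDeriv, this, deriv_const]
  obtain ⟨hR1, hR2⟩ := hasDerivAt_deriv_of_contDiffAt hr.smooth_R.self_of_nhds
  have hR0 := hr.pos_R.ne'
  have hh0 := hr.pos_h.ne'
  have e3 : ∀ k : Fin 3, k ≠ 0 → partialDeriv 0 (christoffel (sphericalMetric h R) k 0 k) x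
      = (deriv (deriv R) (x 0) * R (x 0) - deriv R (x 0) * deriv R (x 0)) / R (x 0) ^ 2 := by
    intro k hk
    have : (fun t => christoffel (sphericalMetric h R) k 0 k (Function.update x 0 t))
        =ᶠ[𝓝 (x 0)] fun t => deriv R t / R t := by
      filter_upwards [hΓ, hr.eventually] with t ht hreg
      have := hreg.2.2.2.ne'
      rw [update_three_zero, ht _ hs]
      fin_cases k
      · exact absurd rfl hk
      · simp [sphericalChristoffel, sphericalMetricDeriv]
        field_simp
      · simp [sphericalChristoffel, sphericalMetricDeriv]
        field_simp
    rw [partialDeriv, this.deriv_eq]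
    exact (hR2.div hR1 hR0).deriv
  rw [ricci]
  simp only [Fin.sum_univ_three, sub_self, d1, d2, e3 1 (by decide), e3 2 (by decide), hΓx]
  simp [sphericalChristoffel, sphericalMetricDeriv]
  field_simp
  ring

/-- The conormal has only its radial component, so χ_AB = −Γ^0_AB n_0. -/
theorem secondFundamentalForm_sphericalMetric {h R : ℝ → ℝ} {c : ℝ} {y : Fin 2 → ℝ}
    (hr : IsRegularAt h R c) (hs : sin (y 0) ≠ 0) (A B : Fin 2) :
    secondFundamentalForm (sphericalMetric h R) c A B y =
      if A = B then ![R c * deriv R c / √(h c), R c * deriv R c * sin (y 0) ^ 2 / √(h c)] A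
      else 0 := by
  have hs' : sin ((![c, y 0, y 1] : Fin 3 → ℝ) 1) ≠ 0 := hs
  have hR0 := hr.pos_R.ne'
  have hh0 := hr.pos_h.ne'
  have hsq : √(h c) * √(h c) = h c := mul_self_sqrt hr.pos_h.le
  have hsq0 : √(h c) ≠ 0 := (sqrt_pos.2 hr.pos_h).ne'
  have hn : conormal (sphericalMetric h R) 0 ![c, y 0, y 1] = √(h c) := by
    simp only [conormal, if_true]
    rw [sphericalMetric_inv (x := ![c, y 0, y 1]) hh0 hR0 hs']
    simp
  have hn0 : ∀ a : Fin 3, a ≠ 0 → conormal (sphericalMetric h R) a = fun _ => 0 := by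
    intro a ha; ext x; simp [conormal, ha]
  rw [secondFundamentalForm, covDerivConormal, hn0 _ (Fin.succ_ne_zero B)]
  simp only [Fin.sum_univ_three, hn, hn0 1 (by decide), hn0 2 (by decide)]
  rw [christoffel_sphericalMetric (x := ![c, y 0, y 1])
    (hr.smooth_R.self_of_nhds.differentiableAt (by simp)) hh0 hR0 hs']
  fin_cases A <;> fin_cases B <;> simp [sphericalChristoffel, sphericalMetricDeriv, partialDeriv]
  all_goals
    rw [eq_div_iff hsq0]
    field_simp
    rw [sq, hsq]
    try ring

theorem sphereMetric_sphericalMetric (h R : ℝ → ℝ) (c : ℝ) (y : Fin 2 → ℝ) :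
    sphereMetric (sphericalMetric h R) c y = Matrix.diagonal ![R c ^ 2, R c ^ 2 * sin (y 0) ^ 2] := by
  ext A B
  simp only [sphereMetric, inducedMetric, Matrix.of_apply, Fin.sum_univ_three, sphericalMetric]
  fin_cases A <;> fin_cases B <;> simp [partialDeriv, graphMap]

theorem sphereMetric_inv {h R : ℝ → ℝ} {c : ℝ} {y : Fin 2 → ℝ} (hR : R c ≠ 0)
    (hs : sin (y 0) ≠ 0) : (sphereMetric (sphericalMetric h R) c y)⁻¹ =
      Matrix.diagonal ![(R c ^ 2)⁻¹, (R c ^ 2 * sin (y 0) ^ 2)⁻¹] := by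
  rw [sphereMetric_sphericalMetric, inv_diagonal_of_ne_zero]
  · congr 1
    ext i; fin_cases i <;> simp
  · intro i; fin_cases i <;> simp [hR, hs]

theorem meanCurvature_sphericalMetric {h R : ℝ → ℝ} {c : ℝ} {y : Fin 2 → ℝ}
    (hr : IsRegularAt h R c) (hs : sin (y 0) ≠ 0) :
    meanCurvature (sphericalMetric h R) c y = 2 * deriv R c / (R c * √(h c)) := by
  have hR0 := hr.pos_R.ne'
  have hsq0 : √(h c) ≠ 0 := (sqrt_pos.2 hr.pos_h).ne'
  simp only [meanCurvature, Fin.sum_univ_two, sphereMetric_inv hR0 hs,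
    secondFundamentalForm_sphericalMetric hr hs]
  simp
  field_simp
  ring

theorem secondFundamentalFormNormSq_sphericalMetric {h R : ℝ → ℝ} {c : ℝ} {y : Fin 2 → ℝ}
    (hr : IsRegularAt h R c) (hs : sin (y 0) ≠ 0) :
    secondFundamentalFormNormSq (sphericalMetric h R) c y
      = 2 * deriv R c ^ 2 / (R c ^ 2 * h c) := by
  have hR0 := hr.pos_R.ne'
  have hh0 := hr.pos_h.ne'
  have hsq : √(h c) ^ 2 = h c := sq_sqrt hr.pos_h.le
  have hsq0 : √(h c) ≠ 0 := (sqrt_pos.2 hr.pos_h).ne'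
  simp only [secondFundamentalFormNormSq, Fin.sum_univ_two, sphereMetric_inv hR0 hs,
    secondFundamentalForm_sphericalMetric hr hs]
  simp
  nth_rw 5 [← hsq]
  field_simp
  ring

theorem ricciNormal_sphericalMetric {h R : ℝ → ℝ} {c : ℝ} {y : Fin 2 → ℝ}
    (hr : IsRegularAt h R c) (hs : sin (y 0) ≠ 0) :
    ricciNormal (sphericalMetric h R) c y = (-2 * deriv (deriv R) c / R c
      + deriv h c * deriv R c / (h c * R c)) / h c := by
  have hs' : sin ((![c, y 0, y 1] : Fin 3 → ℝ) 1) ≠ 0 := hs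
  have hR0 := hr.pos_R.ne'
  have hh0 := hr.pos_h.ne'
  have hsq : √(h c) ^ 2 = h c := sq_sqrt hr.pos_h.le
  have hsq0 : √(h c) ≠ 0 := (sqrt_pos.2 hr.pos_h).ne'
  have hn : ∀ a, unitNormal (sphericalMetric h R) a ![c, y 0, y 1]
      = if a = 0 then (√(h c))⁻¹ else 0 := by
    intro a
    simp only [unitNormal, conormal, sphericalMetric_inv (x := ![c, y 0, y 1]) hh0 hR0 hs']
    fin_cases a <;> simp [Matrix.diagonal]
    rw [← hsq]
    field_simp
    simp
  simp only [ricciNormal, hn, mul_ite, ite_mul, mul_zero, zero_mul, Finset.sum_ite_eq',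
    Finset.mem_univ, if_true]
  rw [ricci_zero_zero_sphericalMetric (x := ![c, y 0, y 1]) hr hs']
  simp only [Matrix.cons_val_zero]
  rw [mul_assoc, ← mul_inv, mul_self_sqrt hr.pos_h.le, ← div_eq_mul_inv]

/-! ### Calculus in spherical coordinates -/

/-- The unit vector `∂_θ` on the unit sphere. -/
def polarVec (y : Fin 2 → ℝ) : Fin 3 → ℝ :=
  ![cos (y 0) * cos (y 1), cos (y 0) * sin (y 1), -sin (y 0)]

/-- The unit vector `(sin θ)⁻¹ ∂_φ` on the unit sphere. -/
def azimVec (y : Fin 2 → ℝ) : Fin 3 → ℝ := ![-sin (y 1), cos (y 1), 0]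

/-- The derivative of `β` along `∂_θ`. -/
def polarDeriv (β : (Fin 3 → ℝ) → ℝ) (y : Fin 2 → ℝ) : ℝ :=
  fderiv ℝ β (spherePoint y) (polarVec y)

/-- The derivative of `β` along `(sin θ)⁻¹ ∂_φ`. -/
def azimDeriv (β : (Fin 3 → ℝ) → ℝ) (y : Fin 2 → ℝ) : ℝ :=
  fderiv ℝ β (spherePoint y) (azimVec y)

theorem contDiff_pair : ContDiff ℝ ∞ fun p : ℝ × ℝ => (![p.1, p.2] : Fin 2 → ℝ) := by
  rw [contDiff_pi]
  intro i; fin_cases i <;> simp <;> fun_prop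

theorem contDiff_pair_swap : ContDiff ℝ ∞ fun p : ℝ × ℝ => (![p.2, p.1] : Fin 2 → ℝ) := by
  rw [contDiff_pi]
  intro i; fin_cases i <;> simp <;> fun_prop

theorem contDiff_spherePoint : ContDiff ℝ ∞ spherePoint := by
  rw [contDiff_pi]
  intro i; fin_cases i <;> simp [spherePoint] <;> fun_prop

theorem contDiff_polarVec : ContDiff ℝ ∞ polarVec := by
  rw [contDiff_pi]
  intro i; fin_cases i <;> simp [polarVec] <;> fun_prop

theorem contDiff_azimVec : ContDiff ℝ ∞ azimVec := by
  rw [contDiff_pi]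
  intro i; fin_cases i <;> simp [azimVec] <;> fun_prop

theorem contDiff_polarDeriv {β : (Fin 3 → ℝ) → ℝ} (hβ : ContDiff ℝ ∞ β) :
    ContDiff ℝ ∞ (polarDeriv β) :=
  ((hβ.fderiv_right (m := ∞) (by simp)).comp contDiff_spherePoint).clm_apply contDiff_polarVec

theorem contDiff_azimDeriv {β : (Fin 3 → ℝ) → ℝ} (hβ : ContDiff ℝ ∞ β) :
    ContDiff ℝ ∞ (azimDeriv β) :=
  ((hβ.fderiv_right (m := ∞) (by simp)).comp contDiff_spherePoint).clm_apply contDiff_azimVec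

theorem hasDerivAt_spherePoint_polar (θ φ : ℝ) :
    HasDerivAt (fun t => spherePoint ![t, φ]) (polarVec ![θ, φ]) θ := by
  rw [hasDerivAt_pi]
  intro i; fin_cases i <;> simp [spherePoint, polarVec]
  · exact (hasDerivAt_sin θ).mul_const _
  · exact (hasDerivAt_sin θ).mul_const _
  · exact hasDerivAt_cos θ

theorem hasDerivAt_spherePoint_azim (θ φ : ℝ) :
    HasDerivAt (fun t => spherePoint ![θ, t]) (sin θ • azimVec ![θ, φ]) φ := by
  rw [hasDerivAt_pi]
  intro i; fin_cases i <;> simp [spherePoint, azimVec]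
  · exact ((hasDerivAt_cos φ).const_mul _).congr_deriv (by ring)
  · exact (hasDerivAt_sin φ).const_mul _
  · exact hasDerivAt_const _ _

theorem hasDerivAt_polar {β : (Fin 3 → ℝ) → ℝ} {θ φ : ℝ}
    (hβ : DifferentiableAt ℝ β (spherePoint ![θ, φ])) :
    HasDerivAt (fun t => β (spherePoint ![t, φ])) (polarDeriv β ![θ, φ]) θ :=
  hβ.hasFDerivAt.comp_hasDerivAt θ (hasDerivAt_spherePoint_polar θ φ)

theorem hasDerivAt_azim {β : (Fin 3 → ℝ) → ℝ} {θ φ : ℝ}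
    (hβ : DifferentiableAt ℝ β (spherePoint ![θ, φ])) :
    HasDerivAt (fun t => β (spherePoint ![θ, t])) (sin θ * azimDeriv β ![θ, φ]) φ := by
  have := hβ.hasFDerivAt.comp_hasDerivAt φ (hasDerivAt_spherePoint_azim θ φ)
  rwa [map_smul, smul_eq_mul] at this

theorem pair_eta (y : Fin 2 → ℝ) : ![y 0, y 1] = y := by
  ext i; fin_cases i <;> rfl

theorem partialDeriv_polar {β : (Fin 3 → ℝ) → ℝ} {y : Fin 2 → ℝ}
    (hβ : DifferentiableAt ℝ β (spherePoint y)) :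
    partialDeriv 0 (fun z => β (spherePoint z)) y = polarDeriv β y := by
  simp only [partialDeriv, update_two_zero]
  have := (hasDerivAt_polar (θ := y 0) (φ := y 1) (by rwa [pair_eta])).deriv
  rwa [pair_eta] at this

theorem partialDeriv_azim {β : (Fin 3 → ℝ) → ℝ} {y : Fin 2 → ℝ}
    (hβ : DifferentiableAt ℝ β (spherePoint y)) :
    partialDeriv 1 (fun z => β (spherePoint z)) y = sin (y 0) * azimDeriv β y := by
  simp only [partialDeriv, update_two_one]
  have := (hasDerivAt_azim (θ := y 0) (φ := y 1) (by rwa [pair_eta])).deriv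
  rwa [pair_eta] at this

/-- The poles are a null set. This is what allows the meaningless values of inverse metrics at sin θ
= 0 to be ignored throughout. -/
theorem angularIntegral_congr {f g : (Fin 2 → ℝ) → ℝ}
    (h : ∀ y : Fin 2 → ℝ, y 0 ∈ Ioo 0 π → f y = g y) : angularIntegral f = angularIntegral g :=
  intervalIntegral.integral_congr_Ioo_of_le pi_nonneg fun θ hθ =>
    intervalIntegral.integral_congr fun φ _ => h ![θ, φ] hθ

theorem continuous_integral_pair {f : (Fin 2 → ℝ) → ℝ} (hf : Continuous f) :
    Continuous fun θ => ∫ φ in (0 : ℝ)..(2 * π), f ![θ, φ] :=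
  continuous_intervalIntegral_of_continuous (F := fun θ φ => f ![θ, φ])
    (hf.comp contDiff_pair.continuous) _ _

theorem intervalIntegrable_pair {f : (Fin 2 → ℝ) → ℝ} (hf : Continuous f) (θ a b : ℝ) :
    IntervalIntegrable (fun φ => f ![θ, φ]) volume a b :=
  (hf.comp (contDiff_pair.continuous.comp (by fun_prop : Continuous fun φ => (θ, φ)))
    ).intervalIntegrable _ _

theorem angularIntegral_add {f g : (Fin 2 → ℝ) → ℝ} (hf : Continuous f) (hg : Continuous g) :
    angularIntegral (fun y => f y + g y) = angularIntegral f + angularIntegral g := by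
  simp only [angularIntegral]
  rw [← intervalIntegral.integral_add ((continuous_integral_pair hf).intervalIntegrable _ _)
    ((continuous_integral_pair hg).intervalIntegrable _ _)]
  exact intervalIntegral.integral_congr fun θ _ =>
    intervalIntegral.integral_add (intervalIntegrable_pair hf _ _ _)
      (intervalIntegrable_pair hg _ _ _)

theorem angularIntegral_const_mul (k : ℝ) (f : (Fin 2 → ℝ) → ℝ) :
    angularIntegral (fun y => k * f y) = k * angularIntegral f := by
  simp only [angularIntegral, intervalIntegral.integral_const_mul]

theorem angularIntegral_zonal (f : ℝ → ℝ) :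
    angularIntegral (fun y => f (y 0)) = 2 * π * ∫ θ in (0 : ℝ)..π, f θ := by
  simp only [angularIntegral, Matrix.cons_val_zero, intervalIntegral.integral_const, smul_eq_mul,
    intervalIntegral.integral_const_mul, sub_zero]

/-- The Dirichlet energy of `β` on the unit sphere. -/
def sphereEnergy (β : (Fin 3 → ℝ) → ℝ) : ℝ :=
  angularIntegral fun y => (polarDeriv β y ^ 2 + azimDeriv β y ^ 2) * sin (y 0)

/-- The square of the `L²` norm of `β` on the unit sphere. -/
def sphereNormSq (β : (Fin 3 → ℝ) → ℝ) : ℝ :=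
  angularIntegral fun y => β (spherePoint y) ^ 2 * sin (y 0)

theorem spherePoint_two_pi (θ : ℝ) : spherePoint ![θ, 2 * π] = spherePoint ![θ, 0] := by
  simp [spherePoint]

theorem azimVec_two_pi (θ : ℝ) : azimVec ![θ, 2 * π] = azimVec ![θ, 0] := by
  simp [azimVec]

theorem two_mul_sphereNormSq_le {β : (Fin 3 → ℝ) → ℝ} (hβ : ContDiff ℝ ∞ β)
    (hmean : angularIntegral (fun y => β (spherePoint y) * sin (y 0)) = 0) :
    2 * sphereNormSq β ≤ sphereEnergy β := by
  have hd : Differentiable ℝ β := hβ.differentiable (by simp)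
  exact sphere_poincare (f := fun θ φ => β (spherePoint ![θ, φ]))
    (p := fun θ φ => polarDeriv β ![θ, φ]) (q := fun θ φ => azimDeriv β ![θ, φ])
    (hβ.continuous.comp (contDiff_spherePoint.continuous.comp contDiff_pair.continuous))
    ((contDiff_polarDeriv hβ).continuous.comp contDiff_pair.continuous)
    ((contDiff_azimDeriv hβ).continuous.comp contDiff_pair.continuous)
    (fun θ φ => hasDerivAt_polar (hd _)) (fun θ φ => hasDerivAt_azim (hd _))
    (fun θ => by simp only [spherePoint_two_pi]) hmean

/-- The partial derivative of a smooth function in a real variable is smooth. -/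
theorem exists_contDiff_hasDerivAt {E : Type*} [NormedAddCommGroup E] [NormedSpace ℝ E]
    {G : ℝ × E → ℝ} (hG : ContDiff ℝ ∞ G) :
    ∃ G' : ℝ × E → ℝ, ContDiff ℝ ∞ G' ∧ ∀ t x, HasDerivAt (fun s => G (s, x)) (G' (t, x)) t := by
  refine ⟨fun p => fderiv ℝ G p (1, 0),
    (hG.fderiv_right (m := ∞) (by simp)).clm_apply contDiff_const, fun t x => ?_⟩
  exact (hG.differentiable (by simp) (t, x)).hasFDerivAt.comp_hasDerivAt t
    ((hasDerivAt_id t).prodMk (hasDerivAt_const t x))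

/-- Integration by parts on the unit sphere in spherical coordinates. -/
theorem integral_mul_div {f p q P Z : ℝ → ℝ → ℝ} (hf : Continuous (Function.uncurry f))
    (hp : Continuous (Function.uncurry p)) (hq : Continuous (Function.uncurry q))
    (hP : Continuous (Function.uncurry P)) (hZ : Continuous (Function.uncurry Z))
    (hfp : ∀ θ φ, HasDerivAt (fun s => f s φ) (p θ φ) θ)
    (hfq : ∀ θ φ, HasDerivAt (f θ) (sin θ * q θ φ) φ)
    (hpP : ∀ θ φ, HasDerivAt (fun s => sin s * p s φ) (P θ φ) θ)
    (hqZ : ∀ θ φ, HasDerivAt (q θ) (Z θ φ) φ)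
    (hfper : ∀ θ, f θ (2 * π) = f θ 0) (hqper : ∀ θ, q θ (2 * π) = q θ 0) :
    ∫ θ in (0 : ℝ)..π, ∫ φ in (0 : ℝ)..(2 * π), f θ φ * (P θ φ + Z θ φ)
      = -∫ θ in (0 : ℝ)..π, ∫ φ in (0 : ℝ)..(2 * π), (p θ φ ^ 2 + q θ φ ^ 2) * sin θ := by
  have hsin : Continuous (Function.uncurry fun θ _ : ℝ => sin θ) :=
    continuous_sin.comp continuous_fst
  have c1 : Continuous (Function.uncurry fun θ φ => f θ φ * Z θ φ + q θ φ ^ 2 * sin θ) :=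
    (hf.mul hZ).add ((hq.pow 2).mul hsin)
  have c2 : Continuous (Function.uncurry fun θ φ => f θ φ * P θ φ + p θ φ ^ 2 * sin θ) :=
    (hf.mul hP).add ((hp.pow 2).mul hsin)
  have c3 : Continuous (Function.uncurry fun θ φ => f θ φ * (P θ φ + Z θ φ)) :=
    hf.mul (hP.add hZ)
  have c4 : Continuous (Function.uncurry fun θ φ => (p θ φ ^ 2 + q θ φ ^ 2) * sin θ) :=
    ((hp.pow 2).add (hq.pow 2)).mul hsin
  -- P + Z stands for sin θ Δf. The azimuthal part integrates to zero on each circle by periodicity.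
  have hphi : ∀ θ, ∫ φ in (0 : ℝ)..(2 * π), (f θ φ * Z θ φ + q θ φ ^ 2 * sin θ) = 0 := by
    intro θ
    rw [intervalIntegral.integral_eq_sub_of_hasDerivAt (f := fun φ => f θ φ * q θ φ)]
    · simp only [hfper, hqper, sub_self]
    · intro φ _
      exact ((hfq θ φ).mul (hqZ θ φ)).congr_deriv (by ring)
    · exact (c1.uncurry_left θ).intervalIntegrable _ _
  -- The polar boundary term carries a factor sin θ, which vanishes at both ends.
  have htheta : ∫ θ in (0 : ℝ)..π, ∫ φ in (0 : ℝ)..(2 * π), (f θ φ * P θ φ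
      + p θ φ ^ 2 * sin θ) = 0 := by
    rw [intervalIntegral.integral_eq_sub_of_hasDerivAt
      (f := fun θ => ∫ φ in (0 : ℝ)..(2 * π), f θ φ * (sin θ * p θ φ))]
    · simp
    · intro θ _
      exact hasDerivAt_intervalIntegral_of_continuous (F := fun θ φ => f θ φ * (sin θ * p θ φ))
        (hf.mul (hsin.mul hp)) c2
        (fun θ φ => ((hfp θ φ).mul (hpP θ φ)).congr_deriv (by ring)) _ _ θ
    · exact (continuous_intervalIntegral_of_continuous c2 _ _).intervalIntegrable _ _
  have i3 := (continuous_intervalIntegral_of_continuous c3 0 (2 * π)).intervalIntegrable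
    (μ := volume) 0 π
  have i4 := (continuous_intervalIntegral_of_continuous c4 0 (2 * π)).intervalIntegrable
    (μ := volume) 0 π
  rw [eq_neg_iff_add_eq_zero, ← intervalIntegral.integral_add i3 i4]
  refine Eq.trans (intervalIntegral.integral_congr fun θ _ => ?_) htheta
  have h := hphi θ
  have k1 := (c1.uncurry_left θ).intervalIntegrable (μ := volume) 0 (2 * π)
  have k2 := (c2.uncurry_left θ).intervalIntegrable (μ := volume) 0 (2 * π)
  have k3 := (c3.uncurry_left θ).intervalIntegrable (μ := volume) 0 (2 * π)
  have k4 := (c4.uncurry_left θ).intervalIntegrable (μ := volume) 0 (2 * π)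
  have e : (∫ φ in (0 : ℝ)..(2 * π), f θ φ * (P θ φ + Z θ φ))
      + ∫ φ in (0 : ℝ)..(2 * π), (p θ φ ^ 2 + q θ φ ^ 2) * sin θ
      = (∫ φ in (0 : ℝ)..(2 * π), (f θ φ * P θ φ + p θ φ ^ 2 * sin θ))
        + ∫ φ in (0 : ℝ)..(2 * π), (f θ φ * Z θ φ + q θ φ ^ 2 * sin θ) := by
    rw [← intervalIntegral.integral_add k3 k4, ← intervalIntegral.integral_add k2 k1]
    exact intervalIntegral.integral_congr fun φ _ => by ring
  rw [h, add_zero] at e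
  exact e

theorem exists_hasDerivAt_gradient {β : (Fin 3 → ℝ) → ℝ} (hβ : ContDiff ℝ ∞ β) :
    ∃ P Z : ℝ → ℝ → ℝ, Continuous (Function.uncurry P) ∧ Continuous (Function.uncurry Z) ∧
      (∀ θ φ, HasDerivAt (fun t => sin t * polarDeriv β ![t, φ]) (P θ φ) θ) ∧
      ∀ θ φ, HasDerivAt (fun t => azimDeriv β ![θ, t]) (Z θ φ) φ := by
  have hp0 : ContDiff ℝ ∞ fun x : ℝ × ℝ => polarDeriv β ![x.1, x.2] :=
    (contDiff_polarDeriv hβ).comp contDiff_pair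
  have hp : ContDiff ℝ ∞ fun x : ℝ × ℝ => sin x.1 * polarDeriv β ![x.1, x.2] :=
    contDiff_fst.sin.mul hp0
  have hq : ContDiff ℝ ∞ fun x : ℝ × ℝ => azimDeriv β ![x.2, x.1] :=
    (contDiff_azimDeriv hβ).comp contDiff_pair_swap
  obtain ⟨P, hPs, hP⟩ := exists_contDiff_hasDerivAt hp
  obtain ⟨Z, hZs, hZ⟩ := exists_contDiff_hasDerivAt hq
  exact ⟨fun θ φ => P (θ, φ), fun θ φ => Z (φ, θ), hPs.continuous,
    hZs.continuous.comp continuous_swap, fun θ φ => hP θ φ, fun θ φ => hZ φ θ⟩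

/-- Integration by parts on the unit sphere. -/
theorem angularIntegral_mul_div {β : (Fin 3 → ℝ) → ℝ} (hβ : ContDiff ℝ ∞ β) :
    angularIntegral (fun y => β (spherePoint y) *
      (deriv (fun t => sin t * polarDeriv β ![t, y 1]) (y 0)
        + deriv (fun t => azimDeriv β ![y 0, t]) (y 1))) = -sphereEnergy β := by
  have hd : Differentiable ℝ β := hβ.differentiable (by simp)
  obtain ⟨P, Z, hPc, hZc, hP, hZ⟩ := exists_hasDerivAt_gradient hβ
  have := integral_mul_div (f := fun θ φ => β (spherePoint ![θ, φ]))
    (p := fun θ φ => polarDeriv β ![θ, φ]) (q := fun θ φ => azimDeriv β ![θ, φ])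
    (hβ.continuous.comp (contDiff_spherePoint.continuous.comp contDiff_pair.continuous))
    ((contDiff_polarDeriv hβ).continuous.comp contDiff_pair.continuous)
    ((contDiff_azimDeriv hβ).continuous.comp contDiff_pair.continuous) hPc hZc
    (fun θ φ => hasDerivAt_polar (hd _)) (fun θ φ => hasDerivAt_azim (hd _)) hP hZ
    (fun θ => by simp only [spherePoint_two_pi])
    (fun θ => by simp only [azimDeriv, spherePoint_two_pi, azimVec_two_pi])
  rw [sphereEnergy, angularIntegral, angularIntegral]
  simp only [Matrix.cons_val_zero, Matrix.cons_val_one, (hP _ _).deriv, (hZ _ _).deriv]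
  exact this

/-! ### The stability functional of spherically symmetric metrics -/

/-- `R² (χ_AB χ^AB + R_ab n^a n^b)` for the metric `h dx² + R² dΩ²`. -/
def stabilityConst (h R : ℝ → ℝ) (c : ℝ) : ℝ :=
  R c ^ 2 * (2 * deriv R c ^ 2 / (R c ^ 2 * h c) + (-2 * deriv (deriv R) c / R c
      + deriv h c * deriv R c / (h c * R c)) / h c)

theorem sqrt_det_sphereMetric {h R : ℝ → ℝ} {c : ℝ} {y : Fin 2 → ℝ} (hy : 0 ≤ sin (y 0)) :
    √((sphereMetric (sphericalMetric h R) c y).det) = R c ^ 2 * sin (y 0) := by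
  rw [sphereMetric_sphericalMetric, Matrix.det_diagonal, Fin.prod_univ_two]
  rw [show (![R c ^ 2, R c ^ 2 * sin (y 0) ^ 2] : Fin 2 → ℝ) 0 *
    (![R c ^ 2, R c ^ 2 * sin (y 0) ^ 2] : Fin 2 → ℝ) 1 = (R c ^ 2 * sin (y 0)) ^ 2 by
    simp; ring]
  exact sqrt_sq (by positivity)

theorem sphereIntegral_sphericalMetric (h R : ℝ → ℝ) (c : ℝ) (a : (Fin 2 → ℝ) → ℝ) :
    sphereIntegral (sphericalMetric h R) c a
      = R c ^ 2 * angularIntegral fun y => a y * sin (y 0) := by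
  rw [sphereIntegral, ← angularIntegral_const_mul]
  refine angularIntegral_congr fun y hy => ?_
  rw [sqrt_det_sphereMetric (sin_pos_of_mem_Ioo hy).le]
  ring

/-- The radius cancels from the flux √det γ γ^{AB} ∂_B a, leaving (sin θ ∂_θ, (sin θ)⁻¹ ∂_φ) applied
to a. Agreement of `a` with `β` is asked only for 0 < θ < π because `normalSpeed`, one of the
intended values of `a`, degenerates at the poles; the strip is open, so derivatives agree there too.
-/
theorem laplaceBeltrami_sphereMetric {h R : ℝ → ℝ} {c : ℝ} {a : (Fin 2 → ℝ) → ℝ}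
    {β : (Fin 3 → ℝ) → ℝ} (hR : R c ≠ 0) (hβ : ContDiff ℝ ∞ β)
    (ha : ∀ y : Fin 2 → ℝ, y 0 ∈ Ioo 0 π → a y = β (spherePoint y))
    {y : Fin 2 → ℝ} (hy : y 0 ∈ Ioo 0 π) :
    laplaceBeltrami (sphereMetric (sphericalMetric h R) c) a y = (R c ^ 2 * sin (y 0))⁻¹ *
      (deriv (fun t => sin t * polarDeriv β ![t, y 1]) (y 0)
        + deriv (fun t => azimDeriv β ![y 0, t]) (y 1)) := by
  have hd : Differentiable ℝ β := hβ.differentiable (by simp)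
  have hflux : ∀ z : Fin 2 → ℝ, z 0 ∈ Ioo 0 π → ∀ A,
      √((sphereMetric (sphericalMetric h R) c z).det) *
        ∑ B, (sphereMetric (sphericalMetric h R) c z)⁻¹ A B * partialDeriv B a z
      = ![sin (z 0) * polarDeriv β z, azimDeriv β z] A := by
    intro z hz A
    have hs := sin_pos_of_mem_Ioo hz
    have e0 : partialDeriv 0 a z = polarDeriv β z := by
      rw [← partialDeriv_polar (hd _)]
      refine EventuallyEq.deriv_eq ?_
      filter_upwards [isOpen_Ioo.mem_nhds hz] with t ht
      exact ha _ (by rwa [update_two_zero])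
    have e1 : partialDeriv 1 a z = sin (z 0) * azimDeriv β z := by
      rw [← partialDeriv_azim (hd _)]
      refine EventuallyEq.deriv_eq (Eventually.of_forall fun t => ?_)
      exact ha _ (by rwa [update_two_one])
    rw [sqrt_det_sphereMetric hs.le, sphereMetric_inv hR hs.ne', Fin.sum_univ_two, e0, e1]
    fin_cases A <;> simp <;> field_simp
  rw [laplaceBeltrami, sqrt_det_sphereMetric (sin_pos_of_mem_Ioo hy).le, Fin.sum_univ_two]
  congr 2
  · refine EventuallyEq.deriv_eq ?_
    filter_upwards [isOpen_Ioo.mem_nhds hy] with t ht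
    rw [update_two_zero, hflux _ (by exact ht)]
    simp
  · refine EventuallyEq.deriv_eq (Eventually.of_forall fun t => ?_)
    simp only
    rw [update_two_one, hflux _ (by exact hy)]
    simp

/-- The curvature term is constant on the sphere, and the Dirichlet energy is conformally invariant
in dimension two, so R enters only through `stabilityConst`. -/
theorem stabilityForm_sphericalMetric {h R : ℝ → ℝ} {c : ℝ} (hr : IsRegularAt h R c)
    {a : (Fin 2 → ℝ) → ℝ} {β : (Fin 3 → ℝ) → ℝ} (hβ : ContDiff ℝ ∞ β)
    (ha : ∀ y : Fin 2 → ℝ, y 0 ∈ Ioo 0 π → a y = β (spherePoint y)) :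
    stabilityForm (sphericalMetric h R) c a
      = sphereEnergy β - stabilityConst h R c * sphereNormSq β := by
  have hR0 := hr.pos_R.ne'
  have hβc : Continuous fun y => β (spherePoint y) :=
    hβ.continuous.comp contDiff_spherePoint.continuous
  have hp := contDiff_polarDeriv hβ
  have hq := contDiff_azimDeriv hβ
  have hdivc : Continuous fun y : Fin 2 → ℝ => β (spherePoint y) *
      (deriv (fun t => sin t * polarDeriv β ![t, y 1]) (y 0)
        + deriv (fun t => azimDeriv β ![y 0, t]) (y 1)) := by
    obtain ⟨P, Z, hPc, hZc, hP, hZ⟩ := exists_hasDerivAt_gradient hβ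
    simp only [(hP _ _).deriv, (hZ _ _).deriv]
    have e : Continuous fun y : Fin 2 → ℝ => (y 0, y 1) := by fun_prop
    exact hβc.mul ((hPc.comp e).add (hZc.comp e))
  rw [stabilityForm, sphereIntegral, ← neg_neg (sphereEnergy β), ← angularIntegral_mul_div hβ,
    sphereNormSq, sub_eq_add_neg, ← neg_one_mul (angularIntegral _), ← neg_mul,
    ← angularIntegral_const_mul, ← angularIntegral_const_mul, ← angularIntegral_add]
  · refine angularIntegral_congr fun y hy => ?_
    have hs := sin_pos_of_mem_Ioo hy
    rw [laplaceBeltrami_sphereMetric hR0 hβ ha hy, sqrt_det_sphereMetric hs.le, ha y hy,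
      secondFundamentalFormNormSq_sphericalMetric hr hs.ne', ricciNormal_sphericalMetric hr hs.ne',
      stabilityConst]
    have hs0 := hs.ne'
    generalize deriv (fun t => sin t * polarDeriv β ![t, y 1]) (y 0)
        + deriv (fun t => azimDeriv β ![y 0, t]) (y 1) = D
    generalize 2 * deriv R c ^ 2 / (R c ^ 2 * h c) + (-2 * deriv (deriv R) c / R c
      + deriv h c * deriv R c / (h c * R c)) / h c = K
    field_simp
    ring
  · exact continuous_const.mul hdivc
  · exact continuous_const.mul ((hβc.pow 2).mul (continuous_sin.comp (continuous_apply 0)))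

/-! ### Graphs over the unit sphere -/

/-- With the gradient taken in the orthonormal frame of the unit sphere, the chart singularity
separates as the factor sin θ, and the remaining factor is free of it. -/
theorem sqrt_det_inducedMetric_graphMap {h R : ℝ → ℝ} {u : (Fin 3 → ℝ) → ℝ} {y : Fin 2 → ℝ}
    (hu : DifferentiableAt ℝ u (spherePoint y)) (hy : 0 ≤ sin (y 0))
    (hR : 0 ≤ R (u (spherePoint y))) :
    √((inducedMetric (sphericalMetric h R) (graphMap u) y).det) =
      sin (y 0) * (R (u (spherePoint y)) * √(R (u (spherePoint y)) ^ 2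
        + h (u (spherePoint y)) * (polarDeriv u y ^ 2 + azimDeriv u y ^ 2))) := by
  have hX0 := partialDeriv_polar hu
  have hX1 := partialDeriv_azim hu
  rw [Matrix.det_fin_two]
  simp only [inducedMetric, Matrix.of_apply, Fin.sum_univ_three, sphericalMetric, graphMap,
    Matrix.diagonal_apply]
  simp only [Matrix.cons_val_zero, Matrix.cons_val_one, Matrix.cons_val_two, hX0, hX1]
  have e0 : ∀ i j : Fin 2, partialDeriv i (fun z => z j) y = if i = j then 1 else 0 := by
    intro i j
    fin_cases i <;> fin_cases j <;> simp [partialDeriv]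
  simp [e0]
  conv_rhs => rw [← mul_assoc, ← sqrt_sq (mul_nonneg hy hR), ← sqrt_mul (sq_nonneg _)]
  congr 1
  ring

/-! ### The stability criterion -/

/-- Every point of the unit sphere has spherical coordinates in the fundamental rectangle. -/
theorem exists_spherePoint_eq (y : Fin 2 → ℝ) :
    ∃ θ ∈ Icc 0 π, ∃ φ ∈ Icc 0 (2 * π), spherePoint y = spherePoint ![θ, φ] := by
  have hφ : ∀ θ φ, ∃ φ' ∈ Ico 0 (2 * π), spherePoint ![θ, φ] = spherePoint ![θ, φ'] := fun θ =>
    Function.Periodic.exists_mem_Ico₀ (f := fun φ => spherePoint ![θ, φ])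
      (fun φ => by simp [spherePoint]) (by positivity)
  obtain ⟨θ, hθ, h1⟩ := Function.Periodic.exists_mem_Ico₀ (f := fun θ => spherePoint ![θ, y 1])
      (c := 2 * π) (fun φ => by simp [spherePoint]) (by positivity) (y 0)
  simp only [pair_eta] at h1
  rcases le_total θ π with h | h
  · obtain ⟨φ, hφ, h2⟩ := hφ θ (y 1)
    exact ⟨θ, ⟨hθ.1, h⟩, φ, Ico_subset_Icc_self hφ, h1.trans h2⟩
  -- Past the south pole the same point is reached by reflecting θ and turning φ by half a circle.
  · obtain ⟨φ, hφ, h2⟩ := hφ (2 * π - θ) (y 1 + π)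
    refine ⟨2 * π - θ, ⟨by linarith [hθ.2], by linarith⟩, φ, Ico_subset_Icc_self hφ, ?_⟩
    rw [h1, ← h2]
    simp [spherePoint, sin_sub, cos_sub, sin_add, cos_add]

theorem isCompact_range_spherePoint : IsCompact (range spherePoint) := by
  have : range spherePoint = (fun p : ℝ × ℝ => spherePoint ![p.1, p.2]) ''
      (Icc 0 π ×ˢ Icc 0 (2 * π)) := by
    refine Subset.antisymm ?_ (image_subset_iff.2 fun p _ => mem_range_self _)
    rintro _ ⟨y, rfl⟩
    obtain ⟨θ, hθ, φ, hφ, h⟩ := exists_spherePoint_eq y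
    exact ⟨(θ, φ), ⟨hθ, hφ⟩, h.symm⟩
  rw [this]
  exact (isCompact_Icc.prod isCompact_Icc).image
    (contDiff_spherePoint.continuous.comp contDiff_pair.continuous)

/-- The weight sin θ vanishes at the poles, so a nonzero value is first moved to some 0 < θ < π by
continuity. -/
theorem sphereNormSq_pos {β : (Fin 3 → ℝ) → ℝ} (hβ : Continuous β)
    (hne : ∃ y, β (spherePoint y) ≠ 0) : 0 < sphereNormSq β := by
  have hc : Continuous fun y => β (spherePoint y) ^ 2 * sin (y 0) :=
    ((hβ.comp contDiff_spherePoint.continuous).pow 2).mul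
      (continuous_sin.comp (continuous_apply 0))
  have hnn : ∀ θ ∈ Icc 0 π, ∀ φ, 0 ≤ β (spherePoint ![θ, φ]) ^ 2 * sin θ := fun θ hθ φ =>
    mul_nonneg (sq_nonneg _) (sin_nonneg_of_nonneg_of_le_pi hθ.1 hθ.2)
  obtain ⟨y, hy⟩ := hne
  obtain ⟨θ₀, hθ₀, φ, hφ, h⟩ := exists_spherePoint_eq y
  rw [h] at hy
  obtain ⟨θ, hθ, hne⟩ : ∃ θ ∈ Ioo 0 π, β (spherePoint ![θ, φ]) ≠ 0 := by
    by_contra! hall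
    have hcl : IsClosed {θ | β (spherePoint ![θ, φ]) = 0} := by
      refine isClosed_eq (hβ.comp (contDiff_spherePoint.continuous.comp
        (contDiff_pair.continuous.comp (by fun_prop : Continuous fun θ : ℝ => (θ, φ)))))
        continuous_const
    have := closure_minimal (show Ioo 0 π ⊆ _ from hall) hcl
    rw [closure_Ioo pi_ne_zero.symm] at this
    exact hy (this hθ₀)
  refine intervalIntegral.integral_pos pi_pos (continuous_integral_pair hc).continuousOn
    (fun θ hθ => intervalIntegral.integral_nonneg (by positivity)
      fun φ _ => hnn θ (Ioc_subset_Icc_self hθ) φ) ⟨θ, Ioo_subset_Icc_self hθ, ?_⟩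
  refine intervalIntegral.integral_pos (by positivity)
    (hc.comp (contDiff_pair.continuous.comp
      (by fun_prop : Continuous fun φ : ℝ => (θ, φ)))).continuousOn
    (fun φ _ => hnn θ (Ioo_subset_Icc_self hθ) φ) ⟨φ, hφ, ?_⟩
  have := sin_pos_of_mem_Ioo hθ
  simp only [Matrix.cons_val_zero]
  positivity

theorem isTestFunction_sphericalMetric {h R : ℝ → ℝ} {c : ℝ} (hR : R c ≠ 0)
    {α : (Fin 3 → ℝ) → ℝ} : IsTestFunction (sphericalMetric h R) c α ↔
      ContDiff ℝ ∞ α ∧ angularIntegral (fun y => α (spherePoint y) * sin (y 0)) = 0 := by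
  rw [IsTestFunction, sphereIntegral_sphericalMetric, mul_eq_zero_iff_left (by positivity)]

theorem integral_sin_mul_cos_sq : ∫ θ in (0 : ℝ)..π, cos θ ^ 2 * sin θ = 2 / 3 := by
  rw [intervalIntegral.integral_eq_sub_of_hasDerivAt (f := fun θ => -cos θ ^ 3 / 3)]
  · simp; norm_num
  · intro θ _
    exact (((hasDerivAt_cos θ).pow 3).neg.div_const 3).congr_deriv (by push_cast; ring)
  · apply Continuous.intervalIntegrable; fun_prop

theorem angularIntegral_height_mul_sin :
    angularIntegral (fun y => spherePoint y 2 * sin (y 0)) = 0 := by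
  have := angularIntegral_zonal fun θ => cos θ * sin θ
  refine Eq.trans ?_ (this.trans ?_)
  · rfl
  · rw [intervalIntegral.integral_eq_sub_of_hasDerivAt (f := fun θ => sin θ ^ 2 / 2)]
    · simp
    · intro θ _
      exact (((hasDerivAt_sin θ).pow 2).div_const 2).congr_deriv (by push_cast; ring)
    · apply Continuous.intervalIntegrable; fun_prop

theorem sphereNormSq_height : sphereNormSq (fun x => x 2) = 4 * π / 3 := by
  have := angularIntegral_zonal fun θ => cos θ ^ 2 * sin θ
  refine Eq.trans ?_ (this.trans ?_)
  · rfl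
  · rw [integral_sin_mul_cos_sq]; ring

theorem sphereEnergy_height : sphereEnergy (fun x => x 2) = 8 * π / 3 := by
  have hd : ∀ x v : Fin 3 → ℝ, fderiv ℝ (fun x : Fin 3 → ℝ => x 2) x v = v 2 := by
    intro x v
    rw [(hasFDerivAt_apply (𝕜 := ℝ) (2 : Fin 3) x).fderiv]
    rfl
  have h1 := angularIntegral_zonal fun θ => sin θ - cos θ ^ 2 * sin θ
  refine Eq.trans ?_ (h1.trans ?_)
  · refine angularIntegral_congr fun y _ => ?_
    simp only [polarDeriv, azimDeriv, hd]
    simp only [polarVec, azimVec]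
    simp only [Matrix.cons_val]
    rw [neg_sq, sin_sq]
    ring
  · rw [intervalIntegral.integral_sub, integral_sin_mul_cos_sq, integral_sin]
    · simp; ring
    all_goals apply Continuous.intervalIntegrable; fun_prop

theorem contDiff_height : ContDiff ℝ ∞ fun x : Fin 3 → ℝ => x 2 := by fun_prop

theorem isTestFunction_height {h R : ℝ → ℝ} {c : ℝ} (hR : R c ≠ 0) :
    IsTestFunction (sphericalMetric h R) c fun x => x 2 :=
  (isTestFunction_sphericalMetric hR).2 ⟨contDiff_height, angularIntegral_height_mul_sin⟩

/-- The height function is an eigenfunction for the eigenvalue 2, hence extremal in the Poincaré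
inequality: a single test function detects every failure of stability. -/
theorem stabilityForm_height {h R : ℝ → ℝ} {c : ℝ} (hr : IsRegularAt h R c) :
    stabilityForm (sphericalMetric h R) c (fun y => spherePoint y 2)
      = (2 - stabilityConst h R c) * (4 * π / 3) := by
  rw [stabilityForm_sphericalMetric hr contDiff_height fun _ _ => rfl, sphereEnergy_height,
    sphereNormSq_height]
  ring

theorem le_stabilityForm {h R : ℝ → ℝ} {c : ℝ} (hr : IsRegularAt h R c) {α : (Fin 3 → ℝ) → ℝ}
    (hα : IsTestFunction (sphericalMetric h R) c α) :
    (2 - stabilityConst h R c) * sphereNormSq α ≤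
      stabilityForm (sphericalMetric h R) c (fun y => α (spherePoint y)) := by
  obtain ⟨h1, h2⟩ := (isTestFunction_sphericalMetric hr.pos_R.ne').1 hα
  rw [stabilityForm_sphericalMetric hr h1 fun _ _ => rfl]
  linarith [two_mul_sphereNormSq_le h1 h2]

theorem sphereNormSq_nonneg {β : (Fin 3 → ℝ) → ℝ} : 0 ≤ sphereNormSq β :=
  intervalIntegral.integral_nonneg pi_nonneg fun θ hθ =>
    intervalIntegral.integral_nonneg (by positivity) fun φ _ =>
      mul_nonneg (sq_nonneg _) (sin_nonneg_of_nonneg_of_le_pi hθ.1 hθ.2)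

theorem isStable_iff {h R : ℝ → ℝ} {c : ℝ} (hr : IsRegularAt h R c)
    (hiso : IsIsoperimetric (sphericalMetric h R) c) :
    IsStable (sphericalMetric h R) c ↔ stabilityConst h R c < 2 := by
  constructor
  · intro hs
    have := hs.2 _ (isTestFunction_height hr.pos_R.ne') ⟨![0, 0], by simp [spherePoint]⟩
    rw [stabilityForm_height hr] at this
    have := pos_of_mul_pos_left this (by positivity)
    linarith
  · refine fun hK => ⟨hiso, fun α hα hne => lt_of_lt_of_le ?_ (le_stabilityForm hr hα)⟩
    exact mul_pos (by linarith) (sphereNormSq_pos hα.1.continuous hne)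

theorem isWeaklyStable_iff {h R : ℝ → ℝ} {c : ℝ} (hr : IsRegularAt h R c)
    (hiso : IsIsoperimetric (sphericalMetric h R) c) :
    IsWeaklyStable (sphericalMetric h R) c ↔ stabilityConst h R c ≤ 2 := by
  constructor
  · intro hs
    have := hs.2 _ (isTestFunction_height hr.pos_R.ne')
    rw [stabilityForm_height hr] at this
    have := nonneg_of_mul_nonneg_left this (by positivity)
    linarith
  · refine fun hK => ⟨hiso, fun α hα => le_trans ?_ (le_stabilityForm hr hα)⟩
    exact mul_nonneg (by linarith) sphereNormSq_nonneg

theorem isUnstable_iff {h R : ℝ → ℝ} {c : ℝ} (hr : IsRegularAt h R c) :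
    IsUnstable (sphericalMetric h R) c ↔ 2 < stabilityConst h R c := by
  constructor
  · rintro ⟨α, hα, hneg⟩
    by_contra! hK
    have := le_stabilityForm hr hα
    have := mul_nonneg (sub_nonneg.2 hK) (sphereNormSq_nonneg (β := α))
    linarith
  · intro hK
    refine ⟨_, isTestFunction_height hr.pos_R.ne', ?_⟩
    rw [stabilityForm_height hr]
    exact mul_neg_of_neg_of_pos (by linarith) (by positivity)

theorem sphereArea_sphericalMetric {h R : ℝ → ℝ} {c : ℝ} :
    sphereArea (sphericalMetric h R) c = 4 * π * R c ^ 2 := by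
  have h1 : sphereArea (sphericalMetric h R) c
      = sphereIntegral (sphericalMetric h R) c fun _ => 1 := by
    simp only [sphereArea, graphArea, sphereIntegral, sphereMetric, one_mul]
  rw [h1, sphereIntegral_sphericalMetric]
  have := angularIntegral_zonal fun θ => 1 * sin θ
  rw [this]
  simp
  ring

/-! ### Cutoffs and the local inverse -/

/-- A function that is smooth near `c` agrees near `c` with a globally smooth function, which can
be taken positive if the given function is positive at `c`. -/
theorem exists_contDiff_eventuallyEq {f : ℝ → ℝ} {c : ℝ} (hf : ∀ᶠ x in 𝓝 c, ContDiffAt ℝ ∞ f x) :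
    ∃ g : ℝ → ℝ, ContDiff ℝ ∞ g ∧ g =ᶠ[𝓝 c] f ∧ (0 < f c → ∀ x, 0 < g x) := by
  have hpos : ∀ᶠ x in 𝓝 c, 0 < f c → 0 < f x := by
    by_cases h : 0 < f c
    · filter_upwards [hf.self_of_nhds.continuousAt.eventually_const_lt h] with x hx _ using hx
    · exact Eventually.of_forall fun x h' => absurd h' h
  obtain ⟨r, hr, hball⟩ := Metric.eventually_nhds_iff_ball.1 (hf.and hpos)
  let χ : ContDiffBump c := ⟨r / 4, r / 2, by positivity, by linarith⟩
  -- Interpolating with the constant 1 instead of 0 keeps the extension positive where the cutoff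
  -- vanishes.
  refine ⟨fun x => χ x * f x + (1 - χ x), ?_, ?_, ?_⟩
  · rw [contDiff_iff_contDiffAt]
    intro x
    by_cases hx : x ∈ Metric.ball c r
    · exact (χ.contDiff.contDiffAt.mul (hball x hx).1).add
        (contDiffAt_const.sub χ.contDiff.contDiffAt)
    · have hx' : r / 2 < dist x c := by
        have : r ≤ dist x c := not_lt.1 hx
        linarith
      have : (fun x => χ x * f x + (1 - χ x)) =ᶠ[𝓝 x] fun _ => 1 := by
        filter_upwards [(continuous_id.dist continuous_const).continuousAt.eventually_const_lt hx']
          with z hz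
        simp [χ.zero_of_le_dist (x := z) hz.le]
      exact contDiffAt_const.congr_of_eventuallyEq this
  · filter_upwards [Metric.closedBall_mem_nhds c χ.rIn_pos] with x hx
    simp [χ.one_of_mem_closedBall hx]
  · intro hc x
    by_cases hx : x ∈ Metric.ball c r
    · have h1 := (hball x hx).2 hc
      rcases (χ.nonneg (x := x)).eq_or_lt with h0 | h0
      · simp [← h0]
      · have := χ.le_one (x := x)
        have := mul_pos h0 h1
        simp only
        linarith
    · have hx' : r / 2 ≤ dist x c := by
        have : r ≤ dist x c := not_lt.1 hx
        linarith
      simp [χ.zero_of_le_dist (x := x) hx']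

/-- A smooth function with nonvanishing derivative has a smooth local right inverse that extends to
the whole line. -/
theorem exists_contDiff_rightInverse {V ρ : ℝ → ℝ} {c : ℝ} (hV : ContDiff ℝ ∞ V)
    (hρ : ∀ x, HasDerivAt V (ρ x) x) (hpos : ∀ x, 0 < ρ x) :
    ∃ W : ℝ → ℝ, ContDiff ℝ ∞ W ∧ W (V c) = c ∧ ∀ᶠ s in 𝓝 (V c), V (W s) = s := by
  have hd : HasFDerivAt V
      ((ContinuousLinearEquiv.unitsEquivAut ℝ (Units.mk0 (ρ c) (hpos c).ne') : ℝ ≃L[ℝ] ℝ) :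
        ℝ →L[ℝ] ℝ) c := by
    refine (hρ c).hasFDerivAt.congr_fderiv ?_
    ext
    simp [ContinuousLinearEquiv.unitsEquivAut_apply]
  let e := (hV.contDiffAt (x := c)).toOpenPartialHomeomorph V hd (by simp)
  have he : (e : ℝ → ℝ) = V := ContDiffAt.toOpenPartialHomeomorph_coe _ _ _
  have hmem : c ∈ e.source := ContDiffAt.mem_toOpenPartialHomeomorph_source _ _ _
  have hVc : V c ∈ e.target := he ▸ e.map_source hmem
  have hsm : ∀ᶠ s in 𝓝 (V c), ContDiffAt ℝ ∞ e.symm s := by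
    filter_upwards [e.open_target.mem_nhds hVc] with s hs
    exact e.contDiffAt_symm_deriv (hpos _).ne' hs (he ▸ hρ _) (he ▸ hV.contDiffAt)
  obtain ⟨W, hW, hWe, -⟩ := exists_contDiff_eventuallyEq hsm
  refine ⟨W, hW, ?_, ?_⟩
  · rw [hWe.self_of_nhds]
    have := e.left_inv hmem
    rwa [he] at this
  · filter_upwards [hWe, e.open_target.mem_nhds hVc] with s h1 h2
    rw [h1]
    have := e.right_inv h2
    rwa [he] at this

/-! ### Smooth families of graphs -/

/-- Compactness of the sphere makes the smallness of t uniform. It keeps the whole graph in the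
neighbourhood of c where the coefficients agree with their global smooth extensions. -/
theorem eventually_forall_spherePoint {k : ℝ × (Fin 3 → ℝ) → ℝ} (hk : Continuous k) {c : ℝ}
    (h0 : ∀ y, k (0, spherePoint y) = c) {N : Set ℝ} (hN : N ∈ 𝓝 c) :
    ∀ᶠ t in 𝓝 (0 : ℝ), ∀ y, k (t, spherePoint y) ∈ N := by
  have := isCompact_range_spherePoint.eventually_forall_of_forall_eventually (x₀ := (0 : ℝ))
    (P := fun t x => k (t, x) ∈ N) (by
      rintro _ ⟨y, rfl⟩
      exact hk.continuousAt.eventually (by rw [h0]; exact hN))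
  filter_upwards [this] with t ht y using ht _ (mem_range_self y)

/-- The partial differential of a function on `ℝ × E` in the direction `e` of `E`. -/
theorem fderiv_slice {E : Type*} [NormedAddCommGroup E] [NormedSpace ℝ E] {U : ℝ × E → ℝ}
    (hU : Differentiable ℝ U) (t : ℝ) (x e : E) :
    fderiv ℝ (fun z => U (t, z)) x e = fderiv ℝ U (t, x) (0, e) := by
  have := (hU (t, x)).hasFDerivAt.comp x ((hasFDerivAt_const t x).prodMk (hasFDerivAt_id x))
  have h2 : HasFDerivAt (fun z => U (t, z)) _ x := this
  rw [h2.fderiv]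
  simp

theorem hasDerivAt_slice {E : Type*} [NormedAddCommGroup E] [NormedSpace ℝ E] {F : Type*}
    [NormedAddCommGroup F] [NormedSpace ℝ F] {U : ℝ × E → F}
    (hU : Differentiable ℝ U) (t : ℝ) (x : E) :
    HasDerivAt (fun s => U (s, x)) (fderiv ℝ U (t, x) (1, 0)) t :=
  (hU (t, x)).hasFDerivAt.comp_hasDerivAt t ((hasDerivAt_id t).prodMk (hasDerivAt_const t x))

/-- The parameter derivative commutes with the differential in the space variable. -/
theorem hasDerivAt_fderiv_slice {E : Type*} [NormedAddCommGroup E] [NormedSpace ℝ E]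
    {U : ℝ × E → ℝ} (hU : ContDiff ℝ ∞ U) (t : ℝ) (x e : E) :
    HasDerivAt (fun s => fderiv ℝ (fun z => U (s, z)) x e)
      (fderiv ℝ (fun z => deriv (fun s => U (s, z)) t) x e) t := by
  have hd : Differentiable ℝ U := hU.differentiable (by simp)
  have hU' : ContDiff ℝ ∞ (fderiv ℝ U) := hU.fderiv_right (by simp)
  have hd' : Differentiable ℝ (fderiv ℝ U) := hU'.differentiable (by simp)
  have e1 : (fun s => fderiv ℝ (fun z => U (s, z)) x e) = fun s => fderiv ℝ U (s, x) (0, e) := by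
    ext s; exact fderiv_slice hd s x e
  have e2 : (fun z => deriv (fun s => U (s, z)) t) = fun z => fderiv ℝ U (t, z) (1, 0) := by
    ext z; exact (hasDerivAt_slice hd t z).deriv
  rw [e1, e2]
  have e3 : fderiv ℝ (fun z => fderiv ℝ U (t, z) (1, 0)) x e
      = fderiv ℝ (fderiv ℝ U) (t, x) (0, e) (1, 0) := by
    have h1 : Differentiable ℝ fun p => fderiv ℝ U p (1, 0) :=
      hd'.clm_apply (differentiable_const _)
    rw [fderiv_slice (U := fun p => fderiv ℝ U p (1, 0)) h1]
    rw [fderiv_clm_apply (hd' _) (differentiableAt_const _)]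
    simp
  rw [e3, (hU.contDiffAt.isSymmSndFDerivAt
    (by simp; exact WithTop.coe_le_coe.2 le_top)).eq]
  have := (hasDerivAt_slice hd' t x).clm_apply (hasDerivAt_const t ((0 : ℝ), e))
  simpa using this

theorem contDiff_polarDeriv_family {u : ℝ → (Fin 3 → ℝ) → ℝ}
    (hu : ContDiff ℝ ∞ fun p : ℝ × (Fin 3 → ℝ) => u p.1 p.2) :
    ContDiff ℝ ∞ fun p : ℝ × (Fin 2 → ℝ) => polarDeriv (u p.1) p.2 := by
  have hd := hu.differentiable (by simp)
  have : (fun p : ℝ × (Fin 2 → ℝ) => polarDeriv (u p.1) p.2) = fun p =>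
      fderiv ℝ (fun p : ℝ × (Fin 3 → ℝ) => u p.1 p.2) (p.1, spherePoint p.2)
        (0, polarVec p.2) := by
    ext p; exact fderiv_slice hd p.1 _ _
  rw [this]
  exact ((hu.fderiv_right (m := ∞) (by simp)).comp (contDiff_fst.prodMk
    (contDiff_spherePoint.comp contDiff_snd))).clm_apply
    (contDiff_const.prodMk (contDiff_polarVec.comp contDiff_snd))

theorem contDiff_azimDeriv_family {u : ℝ → (Fin 3 → ℝ) → ℝ}
    (hu : ContDiff ℝ ∞ fun p : ℝ × (Fin 3 → ℝ) => u p.1 p.2) :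
    ContDiff ℝ ∞ fun p : ℝ × (Fin 2 → ℝ) => azimDeriv (u p.1) p.2 := by
  have hd := hu.differentiable (by simp)
  have : (fun p : ℝ × (Fin 2 → ℝ) => azimDeriv (u p.1) p.2) = fun p =>
      fderiv ℝ (fun p : ℝ × (Fin 3 → ℝ) => u p.1 p.2) (p.1, spherePoint p.2)
        (0, azimVec p.2) := by
    ext p; exact fderiv_slice hd p.1 _ _
  rw [this]
  exact ((hu.fderiv_right (m := ∞) (by simp)).comp (contDiff_fst.prodMk
    (contDiff_spherePoint.comp contDiff_snd))).clm_apply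
    (contDiff_const.prodMk (contDiff_azimVec.comp contDiff_snd))

theorem hasDerivAt_angularIntegral {G G' : ℝ × (Fin 2 → ℝ) → ℝ} (hG : Continuous G)
    (hG' : Continuous G') (h : ∀ t y, HasDerivAt (fun s => G (s, y)) (G' (t, y)) t) (t : ℝ) :
    HasDerivAt (fun s => angularIntegral fun y => G (s, y))
      (angularIntegral fun y => G' (t, y)) t := by
  have hpair : Continuous fun p : ℝ × ℝ × ℝ => (p.1, (![p.2.1, p.2.2] : Fin 2 → ℝ)) :=
    continuous_fst.prodMk (contDiff_pair.continuous.comp continuous_snd)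
  exact hasDerivAt_integral_integral_of_continuous
    (F := fun t θ φ => G (t, ![θ, φ])) (F' := fun t θ φ => G' (t, ![θ, φ]))
    (hG.comp hpair) (hG'.comp hpair) (fun t θ φ => h t _) 0 π 0 (2 * π) t

/-- The derivatives at `0` of `s (G(w) + E (p² + q²))` when `w(0)` is a critical point of `G` and
`p`, `q` vanish at `0`. -/
theorem second_derivative_at_critical {G G' w w' p p' q q' E E' F F' : ℝ → ℝ} {c s G₂ : ℝ}
    (hG : ∀ x, HasDerivAt G (G' x) x) (hG' : HasDerivAt G' G₂ c) (hcrit : G' c = 0)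
    (hw0 : w 0 = c) (hw : ∀ t, HasDerivAt w (w' t) t) (hw' : DifferentiableAt ℝ w' 0)
    (hp0 : p 0 = 0) (hp : ∀ t, HasDerivAt p (p' t) t) (hp' : DifferentiableAt ℝ p' 0)
    (hq0 : q 0 = 0) (hq : ∀ t, HasDerivAt q (q' t) t) (hq' : DifferentiableAt ℝ q' 0)
    (hE : ∀ t, HasDerivAt E (E' t) t) (hE' : DifferentiableAt ℝ E' 0)
    (hF : ∀ t, F t = s * (G (w t) + E t * (p t ^ 2 + q t ^ 2)))
    (hFF' : ∀ t, HasDerivAt F (F' t) t) :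
    F' 0 = 0 ∧ HasDerivAt F' (s * (G₂ * w' 0 ^ 2 + 2 * E 0 * (p' 0 ^ 2 + q' 0 ^ 2))) 0 := by
  have hF'eq : F' = fun t => s * (G' (w t) * w' t + (E' t * (p t ^ 2 + q t ^ 2)
      + E t * (2 * p t * p' t + 2 * q t * q' t))) := by
    ext t
    refine (hFF' t).unique ?_
    have : F = fun t => s * (G (w t) + E t * (p t ^ 2 + q t ^ 2)) := funext hF
    rw [this]
    have h1 := (hG (w t)).comp t (hw t)
    have h2 := (hE t).mul (((hp t).pow 2).add ((hq t).pow 2))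
    refine ((h1.add h2).const_mul s).congr_deriv ?_
    simp only [Pi.pow_apply, Pi.add_apply]
    push_cast
    ring
  constructor
  · simp [hF'eq, hw0, hcrit, hp0, hq0]
  -- Second derivatives of w drop out because G'(c) = 0, and those of p, q and all derivatives of E
  -- because p and q vanish at 0.
  · rw [hF'eq]
    have h1 : HasDerivAt (fun t => G' (w t)) (G₂ * w' 0) 0 := by
      rw [← hw0] at hG'
      exact hG'.comp 0 (hw 0)
    have h2 := h1.mul hw'.hasDerivAt
    have h3 := hE'.hasDerivAt.mul (((hp 0).pow 2).add ((hq 0).pow 2))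
    have h4 := (hE 0).mul ((((hp 0).const_mul 2).mul hp'.hasDerivAt).add
      (((hq 0).const_mul 2).mul hq'.hasDerivAt))
    refine ((h2.add (h3.add h4)).const_mul s).congr_deriv ?_
    simp only [Pi.pow_apply, Pi.add_apply, Pi.mul_apply]
    simp [hw0, hcrit, hp0, hq0]
    left
    ring

/-! ### The second variation of area -/

theorem conormal_sphericalMetric {h R : ℝ → ℝ} {c : ℝ} {y : Fin 2 → ℝ}
    (hr : IsRegularAt h R c) (hs : sin (y 0) ≠ 0) :
    conormal (sphericalMetric h R) 0 ![c, y 0, y 1] = √(h c) := by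
  have hs' : sin ((![c, y 0, y 1] : Fin 3 → ℝ) 1) ≠ 0 := hs
  simp only [conormal, if_true]
  rw [sphericalMetric_inv (x := ![c, y 0, y 1]) hr.pos_h.ne' hr.pos_R.ne' hs']
  simp

theorem sphereEnergy_const_mul (k : ℝ) {β : (Fin 3 → ℝ) → ℝ} (hβ : Differentiable ℝ β) :
    sphereEnergy (fun x => k * β x) = k ^ 2 * sphereEnergy β := by
  rw [sphereEnergy, sphereEnergy, ← angularIntegral_const_mul]
  congr 1
  ext y
  simp only [polarDeriv, azimDeriv, fderiv_const_mul (hβ _)]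
  simp
  ring

theorem sphereNormSq_const_mul (k : ℝ) (β : (Fin 3 → ℝ) → ℝ) :
    sphereNormSq (fun x => k * β x) = k ^ 2 * sphereNormSq β := by
  rw [sphereNormSq, sphereNormSq, ← angularIntegral_const_mul]
  congr 1
  ext y
  ring

/-- The primitive of the volume density `√h R²` that vanishes at `c`. -/
def volumePrimitive (h R : ℝ → ℝ) (c x : ℝ) : ℝ := ∫ s in c..x, √(h s) * R s ^ 2

section Family

variable {h R H S : ℝ → ℝ} {c : ℝ}

theorem contDiff_volumeDensity (hH : ContDiff ℝ ∞ H) (hS : ContDiff ℝ ∞ S) (hHp : ∀ x, 0 < H x) :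
    ContDiff ℝ ∞ fun s => √(H s) * S s ^ 2 :=
  (hH.sqrt fun x => (hHp x).ne').mul (hS.pow 2)

theorem hasDerivAt_volumePrimitive (hH : ContDiff ℝ ∞ H) (hS : ContDiff ℝ ∞ S)
    (hHp : ∀ x, 0 < H x) (c x : ℝ) :
    HasDerivAt (volumePrimitive H S c) (√(H x) * S x ^ 2) x :=
  ((contDiff_volumeDensity hH hS hHp).continuous.integral_hasStrictDerivAt c x).hasDerivAt

theorem contDiff_volumePrimitive (hH : ContDiff ℝ ∞ H) (hS : ContDiff ℝ ∞ S)
    (hHp : ∀ x, 0 < H x) (c : ℝ) : ContDiff ℝ ∞ (volumePrimitive H S c) := by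
  have hd := hasDerivAt_volumePrimitive hH hS hHp c
  refine contDiff_infty_iff_deriv.2 ⟨fun x => (hd x).differentiableAt, ?_⟩
  rw [show deriv (volumePrimitive H S c) = _ from funext fun x => (hd x).deriv]
  exact contDiff_volumeDensity hH hS hHp

/-- Here `H` and `S` are the global extensions of `h` and `R`. After the replacement the integrand
is smooth for all t, as differentiation under the integral requires. -/
theorem eventually_graphArea_eq {u : ℝ → (Fin 3 → ℝ) → ℝ} (hSp : ∀ x, 0 < S x)
    (hHe : H =ᶠ[𝓝 c] h) (hSe : S =ᶠ[𝓝 c] R)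
    (hu : ContDiff ℝ ∞ fun p : ℝ × (Fin 3 → ℝ) => u p.1 p.2) (h0 : ∀ y, u 0 (spherePoint y) = c) :
    ∀ᶠ t in 𝓝 0, graphArea (sphericalMetric h R) (u t) = angularIntegral fun y =>
      sin (y 0) * (S (u t (spherePoint y)) * √(S (u t (spherePoint y)) ^ 2
        + H (u t (spherePoint y)) * (polarDeriv (u t) y ^ 2 + azimDeriv (u t) y ^ 2))) := by
  filter_upwards [eventually_forall_spherePoint hu.continuous h0 (hHe.and hSe)] with t ht
  refine angularIntegral_congr fun y hy => ?_
  obtain ⟨e1, e2⟩ : H (u t (spherePoint y)) = h (u t (spherePoint y)) ∧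
    S (u t (spherePoint y)) = R (u t (spherePoint y)) := ht y
  have hd : Differentiable ℝ (u t) :=
    (hu.comp (contDiff_const.prodMk contDiff_id)).differentiable (by simp)
  rw [sqrt_det_inducedMetric_graphMap (hd _) (sin_pos_of_mem_Ioo hy).le (e2 ▸ (hSp _).le), e1, e2]

theorem eventually_volumeBetween_eq {u : ℝ → (Fin 3 → ℝ) → ℝ} (hHp : ∀ x, 0 < H x)
    (hHe : H =ᶠ[𝓝 c] h) (hSe : S =ᶠ[𝓝 c] R)
    (hu : ContDiff ℝ ∞ fun p : ℝ × (Fin 3 → ℝ) => u p.1 p.2) (h0 : ∀ y, u 0 (spherePoint y) = c) :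
    ∀ᶠ t in 𝓝 0, volumeBetween (sphericalMetric h R) c (u t) = angularIntegral fun y =>
      sin (y 0) * volumePrimitive H S c (u t (spherePoint y)) := by
  obtain ⟨r, hr, hball⟩ := Metric.eventually_nhds_iff_ball.1 (hHe.and hSe)
  filter_upwards [eventually_forall_spherePoint hu.continuous h0 (Metric.ball_mem_nhds c hr)]
    with t ht
  refine angularIntegral_congr fun y hy => ?_
  rw [volumePrimitive, ← intervalIntegral.integral_const_mul]
  refine intervalIntegral.integral_congr fun x hx => ?_
  -- The volume sees the whole segment from c to the graph, so convexity of the ball is needed, not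
  -- only that the graph lies in it.
  have hx' : x ∈ Metric.ball c r :=
    (convex_ball c r).ordConnected.uIcc_subset (Metric.mem_ball_self hr) (ht y) hx
  obtain ⟨e1, e2⟩ := hball x hx'
  have hs := sin_pos_of_mem_Ioo hy
  simp only [sphericalMetric, Matrix.det_diagonal, Fin.prod_univ_three]
  simp only [Matrix.cons_val]
  rw [e1, e2, show h x * R x ^ 2 * (R x ^ 2 * sin (y 0) ^ 2)
    = h x * (sin (y 0) * R x ^ 2) ^ 2 by ring, sqrt_mul (e1 ▸ (hHp x).le),
    sqrt_sq (by positivity)]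
  ring

theorem contDiff_initialVelocity {u : ℝ → (Fin 3 → ℝ) → ℝ}
    (hu : ContDiff ℝ ∞ fun p : ℝ × (Fin 3 → ℝ) => u p.1 p.2) :
    ContDiff ℝ ∞ fun x => deriv (fun t => u t x) 0 := by
  have : (fun x => deriv (fun t => u t x) 0) =
      fun x => fderiv ℝ (fun p : ℝ × (Fin 3 → ℝ) => u p.1 p.2) (0, x) (1, 0) := by
    ext x; exact (hasDerivAt_slice (hu.differentiable (by simp)) 0 x).deriv
  rw [this]
  exact ((hu.fderiv_right (m := ∞) (by simp)).comp
    (contDiff_const.prodMk contDiff_id)).clm_apply contDiff_const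

/-- Constancy holds on the sphere only; off it the representative is arbitrary, and just the
tangential derivatives vanish. -/
theorem gradient_eq_zero_of_const {v : (Fin 3 → ℝ) → ℝ} (hv : Differentiable ℝ v)
    (h0 : ∀ y, v (spherePoint y) = c) {y : Fin 2 → ℝ} (hy : y 0 ∈ Ioo 0 π) :
    polarDeriv v y = 0 ∧ azimDeriv v y = 0 := by
  have h1 := hasDerivAt_polar (θ := y 0) (φ := y 1) (hv _)
  have h2 := hasDerivAt_azim (θ := y 0) (φ := y 1) (hv _)
  simp only [h0, pair_eta] at h1 h2
  exact ⟨h1.unique (hasDerivAt_const _ _), (mul_eq_zero.1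
    (h2.unique (hasDerivAt_const _ _))).resolve_left (sin_pos_of_mem_Ioo hy).ne'⟩

theorem contDiff_family_spherePoint {u : ℝ → (Fin 3 → ℝ) → ℝ}
    (hu : ContDiff ℝ ∞ fun p : ℝ × (Fin 3 → ℝ) => u p.1 p.2) :
    ContDiff ℝ ∞ fun p : ℝ × (Fin 2 → ℝ) => u p.1 (spherePoint p.2) :=
  hu.comp (contDiff_fst.prodMk (contDiff_spherePoint.comp contDiff_snd))

/-- First and second variation of a functional `∫ (G(u) + E |∇u|²)` on graphs over the unit sphere
at a constant critical point `c` of `G`. -/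
theorem exists_second_variation_functional {u : ℝ → (Fin 3 → ℝ) → ℝ}
    (hu : ContDiff ℝ ∞ fun p : ℝ × (Fin 3 → ℝ) => u p.1 p.2) (h0 : ∀ y, u 0 (spherePoint y) = c)
    {G G' : ℝ → ℝ} {G₂ k : ℝ} (hGs : ContDiff ℝ ∞ G) (hG : ∀ x, HasDerivAt G (G' x) x)
    (hcrit : G' c = 0) (hG₂ : HasDerivAt G' G₂ c) {E : ℝ × (Fin 2 → ℝ) → ℝ}
    (hE : ContDiff ℝ ∞ E) (hE0 : ∀ y : Fin 2 → ℝ, y 0 ∈ Ioo 0 π → E (0, y) = k) :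
    ∃ J' : ℝ → ℝ, (∀ t, HasDerivAt (fun t => angularIntegral fun y => sin (y 0) *
        (G (u t (spherePoint y)) + E (t, y) * (polarDeriv (u t) y ^ 2 + azimDeriv (u t) y ^ 2)))
        (J' t) t) ∧ J' 0 = 0 ∧
      HasDerivAt J' (2 * k * sphereEnergy (fun x => deriv (fun t => u t x) 0)
        + G₂ * sphereNormSq (fun x => deriv (fun t => u t x) 0)) 0 := by
  have hv := contDiff_initialVelocity hu
  have hws := contDiff_family_spherePoint hu
  have hps := contDiff_polarDeriv_family hu
  have hqs := contDiff_azimDeriv_family hu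
  have hsin : ContDiff ℝ ∞ fun z : ℝ × (Fin 2 → ℝ) => sin (z.2 0) := by fun_prop
  have hΦs : ContDiff ℝ ∞ fun z : ℝ × (Fin 2 → ℝ) => sin (z.2 0) *
      (G (u z.1 (spherePoint z.2)) + E z *
        (polarDeriv (u z.1) z.2 ^ 2 + azimDeriv (u z.1) z.2 ^ 2)) :=
    hsin.mul ((hGs.comp hws).add (hE.mul ((hps.pow 2).add (hqs.pow 2))))
  obtain ⟨w', hw's, hw'⟩ := exists_contDiff_hasDerivAt hws
  obtain ⟨p', hp's, hp'⟩ := exists_contDiff_hasDerivAt hps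
  obtain ⟨q', hq's, hq'⟩ := exists_contDiff_hasDerivAt hqs
  obtain ⟨E', hE's, hE'⟩ := exists_contDiff_hasDerivAt hE
  obtain ⟨Φ', hΦ's, hΦ'⟩ := exists_contDiff_hasDerivAt hΦs
  obtain ⟨Φ'', hΦ''s, hΦ''⟩ := exists_contDiff_hasDerivAt hΦ's
  have hslice : ∀ {f : ℝ × (Fin 2 → ℝ) → ℝ}, ContDiff ℝ ∞ f → ∀ y,
      DifferentiableAt ℝ (fun t => f (t, y)) 0 := fun hf y =>
    (hasDerivAt_slice (hf.differentiable (by simp)) 0 y).differentiableAt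
  have hpt : ∀ y : Fin 2 → ℝ, y 0 ∈ Ioo 0 π → Φ' (0, y) = 0 ∧
      Φ'' (0, y) = 2 * k * ((polarDeriv (fun x => deriv (fun t => u t x) 0) y ^ 2
        + azimDeriv (fun x => deriv (fun t => u t x) 0) y ^ 2) * sin (y 0))
        + G₂ * (deriv (fun t => u t (spherePoint y)) 0 ^ 2 * sin (y 0)) := by
    intro y hy
    have hd0 : Differentiable ℝ (u 0) :=
      (hu.comp (contDiff_const.prodMk contDiff_id)).differentiable (by simp)
    obtain ⟨hp0, hq0⟩ := gradient_eq_zero_of_const hd0 h0 hy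
    have hw1 : w' (0, y) = deriv (fun t => u t (spherePoint y)) 0 := (hw' 0 y).deriv.symm
    have hp1 : p' (0, y) = polarDeriv (fun x => deriv (fun t => u t x) 0) y :=
      (hp' 0 y).unique (hasDerivAt_fderiv_slice hu 0 (spherePoint y) (polarVec y))
    have hq1 : q' (0, y) = azimDeriv (fun x => deriv (fun t => u t x) 0) y :=
      (hq' 0 y).unique (hasDerivAt_fderiv_slice hu 0 (spherePoint y) (azimVec y))
    obtain ⟨r1, r2⟩ := second_derivative_at_critical (s := sin (y 0)) hG hG₂ hcrit (h0 y)
      (fun t => hw' t y) (hslice hw's y) hp0 (fun t => hp' t y) (hslice hp's y) hq0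
      (fun t => hq' t y) (hslice hq's y) (fun t => hE' t y) (hslice hE's y) (fun t => rfl)
      (fun t => hΦ' t y)
    refine ⟨r1, ((hΦ'' 0 y).unique r2).trans ?_⟩
    simp only [hE0 y hy, hw1, hp1, hq1]
    ring
  refine ⟨fun t => angularIntegral fun y => Φ' (t, y),
    hasDerivAt_angularIntegral hΦs.continuous hΦ's.continuous hΦ', ?_, ?_⟩
  · have : angularIntegral (fun y => Φ' (0, y)) = angularIntegral fun _ => 0 * 0 :=
      angularIntegral_congr fun y hy => by rw [(hpt y hy).1, zero_mul]
    exact this.trans ((angularIntegral_const_mul _ _).trans (zero_mul _))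
  · refine (hasDerivAt_angularIntegral hΦ's.continuous hΦ''s.continuous hΦ'' 0).congr_deriv ?_
    have cs : Continuous fun y : Fin 2 → ℝ => sin (y 0) :=
      continuous_sin.comp (continuous_apply 0)
    have c1 := (((contDiff_polarDeriv hv).continuous.pow 2).add
      ((contDiff_azimDeriv hv).continuous.pow 2)).mul cs
    have c2 := ((hv.continuous.comp contDiff_spherePoint.continuous).pow 2).mul cs
    rw [sphereEnergy, sphereNormSq, ← angularIntegral_const_mul, ← angularIntegral_const_mul]
    exact (angularIntegral_congr fun y hy => (hpt y hy).2).trans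
      (angularIntegral_add (continuous_const.mul c1) (continuous_const.mul c2))

/-- Rationalising the root exhibits the area density as a² plus a positive coefficient times the
squared gradient, the shape required by `exists_second_variation_functional`. -/
theorem area_integrand_eq {a b P : ℝ} (ha : 0 < a) (hb : 0 < b) (hP : 0 ≤ P) :
    a * √(a ^ 2 + b * P) = a ^ 2 + a * b / (√(a ^ 2 + b * P) + a) * P := by
  have hsq := sq_sqrt (show 0 ≤ a ^ 2 + b * P by positivity)
  set D := √(a ^ 2 + b * P)
  have hden : D + a ≠ 0 := by positivity
  field_simp
  linear_combination hsq

/-- Subtracting λ times the enclosed volume does not change the area of an admissible family, but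
makes c a critical point of R² − λV. Its second derivative there is −h(c) K, which is where the
stability constant appears. -/
theorem exists_second_variation (hr : IsRegularAt h R c) {u : ℝ → (Fin 3 → ℝ) → ℝ}
    (hu : IsVolumePreservingVariation (sphericalMetric h R) c u) :
    ∃ J' : ℝ → ℝ, (∀ᶠ t in 𝓝 0, HasDerivAt (fun s => graphArea (sphericalMetric h R) (u s))
      (J' t) t) ∧ J' 0 = 0 ∧ HasDerivAt J'
        (h c * (sphereEnergy (fun x => deriv (fun t => u t x) 0)
          - stabilityConst h R c * sphereNormSq (fun x => deriv (fun t => u t x) 0))) 0 := by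
  obtain ⟨H, hH, hHe, hHp⟩ := exists_contDiff_eventuallyEq hr.smooth_h
  obtain ⟨S, hS, hSe, hSp⟩ := exists_contDiff_eventuallyEq hr.smooth_R
  replace hHp := hHp hr.pos_h
  replace hSp := hSp hr.pos_R
  have hws := contDiff_family_spherePoint hu.smooth
  have hps := contDiff_polarDeriv_family hu.smooth
  have hqs := contDiff_azimDeriv_family hu.smooth
  have hV := contDiff_volumePrimitive hH hS hHp c
  have hSc : S c = R c := hSe.self_of_nhds
  have hHc : H c = h c := hHe.self_of_nhds
  have hS1 : deriv S c = deriv R c := hSe.deriv_eq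
  have hS2 : deriv (deriv S) c = deriv (deriv R) c := hSe.deriv.deriv_eq
  have hH1 : deriv H c = deriv h c := hHe.deriv_eq
  have hsqH : √(H c) ^ 2 = H c := sq_sqrt (hHp c).le
  have hsqH0 : √(H c) ≠ 0 := (sqrt_pos.2 (hHp c)).ne'
  have hSc0 := (hSp c).ne'
  have hHc0 := (hHp c).ne'
  -- The Lagrange multiplier equals the mean curvature 2R'/(R√h) of the sphere; it is kept opaque
  -- until the two places where its value matters.
  obtain ⟨lam, hlam⟩ : ∃ lam, lam = 2 * S c * deriv S c / (√(H c) * S c ^ 2) := ⟨_, rfl⟩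
  have hGd : ∀ x, HasDerivAt (fun x => S x ^ 2 - lam * volumePrimitive H S c x)
      (2 * S x * deriv S x - lam * (√(H x) * S x ^ 2)) x := by
    intro x
    refine ((((hS.differentiable (by simp) x).hasDerivAt).pow 2).sub
      ((hasDerivAt_volumePrimitive hH hS hHp c x).const_mul lam)).congr_deriv ?_
    push_cast; ring
  have hGd2 : HasDerivAt (fun x => 2 * S x * deriv S x - lam * (√(H x) * S x ^ 2))
      (-(h c * stabilityConst h R c)) c := by
    have s1 := hasDerivAt_deriv_of_contDiffAt (hS.contDiffAt (x := c))
    have h1 := hasDerivAt_deriv_of_contDiffAt (hH.contDiffAt (x := c))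
    refine (((s1.1.const_mul 2).mul s1.2).sub (((h1.1.sqrt hHc0).mul (s1.1.pow 2)).const_mul
      lam)).congr_deriv ?_
    rw [stabilityConst, ← hSc, ← hHc, ← hS1, ← hS2, ← hH1, hlam]
    simp only [Pi.pow_apply]
    push_cast
    field_simp
    rw [hsqH]
    ring
  have hEs : ContDiff ℝ ∞ fun z : ℝ × (Fin 2 → ℝ) =>
      S (u z.1 (spherePoint z.2)) * H (u z.1 (spherePoint z.2)) /
        (√(S (u z.1 (spherePoint z.2)) ^ 2 + H (u z.1 (spherePoint z.2)) *
          (polarDeriv (u z.1) z.2 ^ 2 + azimDeriv (u z.1) z.2 ^ 2))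
          + S (u z.1 (spherePoint z.2))) := by
    have hSw := hS.comp hws
    have hHw := hH.comp hws
    refine (hSw.mul hHw).div (((((hSw.pow 2).add (hHw.mul ((hps.pow 2).add (hqs.pow 2)))).sqrt
      fun z => ?_)).add hSw) fun z => ?_
    · have := hSp (u z.1 (spherePoint z.2))
      have := hHp (u z.1 (spherePoint z.2))
      simp only [Function.comp_apply]
      positivity
    · have := hSp (u z.1 (spherePoint z.2))
      positivity
  -- At t = 0 the gradient vanishes and the coefficient SH/(√(S²) + S) equals h(c)/2.
  obtain ⟨J', hJ, hJ0, hJ2⟩ := exists_second_variation_functional (k := h c / 2) hu.smooth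
    hu.initial ((hS.pow 2).sub (contDiff_const.mul hV)) hGd
    (by rw [hlam]; field_simp; ring) hGd2 hEs (fun y hy => by
      have hd0 : Differentiable ℝ (u 0) :=
        (hu.smooth.comp (contDiff_const.prodMk contDiff_id)).differentiable (by simp)
      obtain ⟨hp0, hq0⟩ := gradient_eq_zero_of_const hd0 hu.initial hy
      simp only [hu.initial, hp0, hq0]
      rw [← hHc]
      simp only [ne_eq, OfNat.ofNat_ne_zero, not_false_eq_true, zero_pow, add_zero, mul_zero,
        sqrt_sq (hSp c).le]
      field_simp
      ring)
  refine ⟨J', ?_, hJ0, hJ2.congr_deriv (by ring)⟩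
  have harea : (fun t => graphArea (sphericalMetric h R) (u t)) =ᶠ[𝓝 0] fun t =>
      angularIntegral fun y => sin (y 0) * (S (u t (spherePoint y)) ^ 2
        - lam * volumePrimitive H S c (u t (spherePoint y)) + S (u t (spherePoint y)) *
          H (u t (spherePoint y)) / (√(S (u t (spherePoint y)) ^ 2 + H (u t (spherePoint y)) *
            (polarDeriv (u t) y ^ 2 + azimDeriv (u t) y ^ 2)) + S (u t (spherePoint y)))
        * (polarDeriv (u t) y ^ 2 + azimDeriv (u t) y ^ 2)) := by
    filter_upwards [eventually_graphArea_eq hSp hHe hSe hu.smooth hu.initial,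
      eventually_volumeBetween_eq hHp hHe hSe hu.smooth hu.initial, hu.volume_eq] with t h1 h2 h3
    rw [h2] at h3
    have hpair : Continuous fun y : Fin 2 → ℝ => (t, y) := by fun_prop
    have cs : Continuous fun y : Fin 2 → ℝ => sin (y 0) :=
      continuous_sin.comp (continuous_apply 0)
    have cV := cs.mul ((hV.comp hws).continuous.comp hpair)
    have hΦ := (((hS.pow 2).sub ((contDiff_const (c := lam)).mul hV)).comp hws).add
      (hEs.mul ((hps.pow 2).add (hqs.pow 2)))
    have cΦ := cs.mul (hΦ.continuous.comp hpair)
    have e := angularIntegral_add cΦ ((continuous_const (y := lam)).mul cV)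
    have e2 := angularIntegral_const_mul lam
      fun y => sin (y 0) * volumePrimitive H S c (u t (spherePoint y))
    rw [h3, mul_zero] at e2
    refine (h1.trans ?_).trans (e.trans ((congrArg _ e2).trans (add_zero _)))
    refine angularIntegral_congr fun y _ => ?_
    rw [area_integrand_eq (hSp _) (hHp _) (by positivity)]
    simp only [Pi.mul_apply, Function.comp_apply]
    ring
  filter_upwards [harea.eventuallyEq_nhds] with t ht
  exact (hJ t).congr_of_eventuallyEq ht

theorem isIsoperimetric_sphericalMetric (hr : IsRegularAt h R c) :
    IsIsoperimetric (sphericalMetric h R) c := by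
  intro u hu
  obtain ⟨J', h1, h2, -⟩ := exists_second_variation hr hu
  exact h1.self_of_nhds.congr_deriv h2

theorem isSecondVariation_sphericalMetric (hr : IsRegularAt h R c) :
    IsSecondVariation (sphericalMetric h R) c := by
  constructor
  · intro u hu
    obtain ⟨J', h1, -, h3⟩ := exists_second_variation hr hu
    refine ⟨h1.mono fun t ht => ht.differentiableAt, ?_⟩
    have hv := contDiff_initialVelocity hu.smooth
    have e : deriv (fun s => graphArea (sphericalMetric h R) (u s)) =ᶠ[𝓝 0] J' :=
      h1.mono fun t ht => ht.deriv
    rw [stabilityForm_sphericalMetric hr (contDiff_const.mul hv)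
      (a := normalSpeed (sphericalMetric h R) c u)
      (β := fun x => √(h c) * deriv (fun t => u t x) 0) (fun y hy => by
        rw [normalSpeed, conormal_sphericalMetric hr (sin_pos_of_mem_Ioo hy).ne'])]
    rw [sphereEnergy_const_mul _ (hv.differentiable (by simp)), sphereNormSq_const_mul,
      sq_sqrt hr.pos_h.le]
    refine (h3.congr_of_eventuallyEq e).congr_deriv ?_
    ring
  · intro α hα
    obtain ⟨hαs, hα0⟩ := (isTestFunction_sphericalMetric hr.pos_R.ne').1 hα
    obtain ⟨H, hH, hHe, hHp⟩ := exists_contDiff_eventuallyEq hr.smooth_h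
    obtain ⟨S, hS, hSe, hSp⟩ := exists_contDiff_eventuallyEq hr.smooth_R
    replace hHp := hHp hr.pos_h
    replace hSp := hSp hr.pos_R
    have hSc : S c = R c := hSe.self_of_nhds
    have hHc : H c = h c := hHe.self_of_nhds
    -- Inverting the volume primitive linearises the constraint: for u_t = W(t R² α) the enclosed
    -- volume is t R² times the integral of α, which is zero.
    obtain ⟨W, hW, hW0, hWV⟩ := exists_contDiff_rightInverse
      (contDiff_volumePrimitive hH hS hHp c) (hasDerivAt_volumePrimitive hH hS hHp c)
      fun x => mul_pos (sqrt_pos.2 (hHp x)) (pow_pos (hSp x) 2)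
    have hV0 : volumePrimitive H S c c = 0 := intervalIntegral.integral_same
    rw [hV0] at hW0 hWV
    have hk : ContDiff ℝ ∞ fun p : ℝ × (Fin 3 → ℝ) => p.1 * (R c ^ 2 * α p.2) :=
      contDiff_fst.mul (contDiff_const.mul (hαs.comp contDiff_snd))
    have hus : ContDiff ℝ ∞ fun p : ℝ × (Fin 3 → ℝ) => W (p.1 * (R c ^ 2 * α p.2)) := hW.comp hk
    have hu0 : ∀ y, W (0 * (R c ^ 2 * α (spherePoint y))) = c := fun y => by rw [zero_mul, hW0]
    refine ⟨fun t x => W (t * (R c ^ 2 * α x)), ⟨hus, hu0, ?_⟩, ?_⟩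
    · filter_upwards [eventually_volumeBetween_eq (u := fun t x => W (t * (R c ^ 2 * α x)))
        hHp hHe hSe hus hu0,
        eventually_forall_spherePoint hk.continuous (fun y => by simp) hWV] with t h1 h2
      rw [h1, angularIntegral_congr (g := fun y => (t * R c ^ 2) *
        (α (spherePoint y) * sin (y 0))) fun y _ => ?_, angularIntegral_const_mul, hα0, mul_zero]
      have : volumePrimitive H S c (W (t * (R c ^ 2 * α (spherePoint y))))
        = t * (R c ^ 2 * α (spherePoint y)) := h2 y
      rw [this]
      ring
    · intro y hy
      rw [normalSpeed, conormal_sphericalMetric hr (sin_pos_of_mem_Ioo hy).ne']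
      have hWd : HasDerivAt W (deriv W 0) 0 := (hW.differentiable (by simp) 0).hasDerivAt
      -- Inverse function rule: W'(0) = 1/(√h R²) cancels the factor R² and the conormal √h, so the
      -- normal speed is exactly α.
      have h1 : √(H c) * S c ^ 2 * deriv W 0 = 1 := by
        have h2 := hasDerivAt_volumePrimitive hH hS hHp c (W 0)
        have h3 := h2.comp 0 hWd
        rw [hW0] at h3
        exact h3.unique ((hasDerivAt_id 0).congr_of_eventuallyEq hWV)
      have h4 : HasDerivAt (fun t => W (t * (R c ^ 2 * α (spherePoint y))))
          (deriv W 0 * (R c ^ 2 * α (spherePoint y))) 0 := by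
        have h5 : HasDerivAt (fun t : ℝ => t * (R c ^ 2 * α (spherePoint y)))
          (R c ^ 2 * α (spherePoint y)) 0 := by
          simpa using (hasDerivAt_id (0 : ℝ)).mul_const (R c ^ 2 * α (spherePoint y))
        exact HasDerivAt.comp (h₂ := W) 0 (by rwa [zero_mul]) h5
      rw [h4.deriv, ← hHc, ← hSc]
      linear_combination α (spherePoint y) * h1

end Family

/-! ### The Reissner–Nordström spheres -/

theorem rnLapse_pos {m Q r : ℝ} (hr : r ∈ rnRange m Q) : 0 < 1 - 2 * m / r + Q ^ 2 / r ^ 2 := by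
  obtain ⟨h0, h1⟩ := hr
  have h2 : 0 < r ^ 2 - 2 * m * r + Q ^ 2 := by
    rcases le_or_gt (Q ^ 2) (m ^ 2) with h | h
    · have h3 := h1 h
      have h4 := sqrt_nonneg (m ^ 2 - Q ^ 2)
      have h5 := sq_sqrt (sub_nonneg.2 h)
      nlinarith
    · nlinarith [sq_nonneg (r - m)]
  have : 1 - 2 * m / r + Q ^ 2 / r ^ 2 = (r ^ 2 - 2 * m * r + Q ^ 2) / r ^ 2 := by
    field_simp
  rw [this]
  positivity

theorem contDiffAt_rnLapse (m Q : ℝ) {r : ℝ} (hr : r ≠ 0) :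
    ContDiffAt ℝ ∞ (fun x => 1 - 2 * m / x + Q ^ 2 / x ^ 2) r :=
  (contDiffAt_const.sub (contDiffAt_const.div contDiffAt_id hr)).add
    (contDiffAt_const.div (contDiffAt_id.pow 2) (pow_ne_zero 2 hr))

theorem isRegularAt_rn {m Q r : ℝ} (hr : r ∈ rnRange m Q) :
    IsRegularAt (rnF m Q) (fun r => r) r := by
  have hpos := rnLapse_pos hr
  refine ⟨?_, Eventually.of_forall fun x => contDiffAt_id, inv_pos.2 hpos, hr.1⟩
  filter_upwards [(contDiffAt_rnLapse m Q hr.1.ne').continuousAt.eventually_ne hpos.ne',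
    eventually_ne_nhds hr.1.ne'] with x h1 h2
  exact (contDiffAt_rnLapse m Q h2).inv h1

/-- With N = 1/f, the general expression collapses to 2N − rN' (the identity `key`), because R = r
has R'' = 0. -/
theorem stabilityConst_rn {m Q r : ℝ} (hr : r ∈ rnRange m Q) :
    stabilityConst (rnF m Q) (fun r => r) r = 2 - 6 * m / r + 4 * Q ^ 2 / r ^ 2 := by
  have hpos := rnLapse_pos hr
  have h0 := hr.1.ne'
  have hN : HasDerivAt (fun x => 1 - 2 * m / x + Q ^ 2 / x ^ 2)
      (2 * m / r ^ 2 - 2 * Q ^ 2 / r ^ 3) r := by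
    refine ((((hasDerivAt_const r (2 * m)).div (hasDerivAt_id r) h0).const_sub 1).add
      ((hasDerivAt_const r (Q ^ 2)).div ((hasDerivAt_id r).pow 2) (pow_ne_zero 2 h0))).congr_deriv ?_
    simp
    field_simp
    ring
  have hd : deriv (rnF m Q) r = -(2 * m / r ^ 2 - 2 * Q ^ 2 / r ^ 3)
      / (1 - 2 * m / r + Q ^ 2 / r ^ 2) ^ 2 := (hN.inv hpos.ne').deriv
  have e1 : deriv (fun r : ℝ => r) = fun _ => 1 := by ext; simp
  rw [stabilityConst, hd, e1]
  simp only [deriv_const, rnF]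
  have hN0 := hpos.ne'
  have key : ∀ N D : ℝ, N ≠ 0 → r ^ 2 * (2 * 1 ^ 2 / (r ^ 2 * N⁻¹) + (-2 * 0 / r
      + -D / N ^ 2 * 1 / (N⁻¹ * r)) / N⁻¹) = 2 * N - r * D := by
    intro N D hN
    field_simp
    ring
  rw [key _ _ hN0]
  field_simp
  ring

theorem isIsoperimetric_rn {m Q r : ℝ} (hr : r ∈ rnRange m Q) :
    IsIsoperimetric (rnMetric m Q) r :=
  isIsoperimetric_sphericalMetric (isRegularAt_rn hr)

theorem isStable_rn_iff {m Q r : ℝ} (hr : r ∈ rnRange m Q) :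
    IsStable (rnMetric m Q) r ↔ 2 * Q ^ 2 < 3 * m * r := by
  have h0 := hr.1
  rw [rnMetric, isStable_iff (isRegularAt_rn hr) (isIsoperimetric_rn hr), stabilityConst_rn hr,
    show 2 - 6 * m / r + 4 * Q ^ 2 / r ^ 2 = 2 - 2 * (3 * m * r - 2 * Q ^ 2) / r ^ 2 by
      field_simp; ring, sub_lt_self_iff]
  rw [div_pos_iff_of_pos_right (by positivity)]
  constructor <;> intro h <;> linarith

theorem isWeaklyStable_rn_iff {m Q r : ℝ} (hr : r ∈ rnRange m Q) :
    IsWeaklyStable (rnMetric m Q) r ↔ 2 * Q ^ 2 ≤ 3 * m * r := by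
  have h0 := hr.1
  rw [rnMetric, isWeaklyStable_iff (isRegularAt_rn hr) (isIsoperimetric_rn hr),
    stabilityConst_rn hr,
    show 2 - 6 * m / r + 4 * Q ^ 2 / r ^ 2 = 2 - 2 * (3 * m * r - 2 * Q ^ 2) / r ^ 2 by
      field_simp; ring, sub_le_self_iff]
  rw [le_div_iff₀ (by positivity), zero_mul]
  constructor <;> intro h <;> linarith

theorem isUnstable_rn_iff {m Q r : ℝ} (hr : r ∈ rnRange m Q) :
    IsUnstable (rnMetric m Q) r ↔ 3 * m * r < 2 * Q ^ 2 := by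
  have h0 := hr.1
  rw [rnMetric, isUnstable_iff (isRegularAt_rn hr), stabilityConst_rn hr,
    show 2 - 6 * m / r + 4 * Q ^ 2 / r ^ 2 = 2 + 2 * (2 * Q ^ 2 - 3 * m * r) / r ^ 2 by
      field_simp; ring, lt_add_iff_pos_right]
  rw [div_pos_iff_of_pos_right (by positivity)]
  constructor <;> intro h <;> linarith

theorem lt_of_mem_rnRange {m Q r : ℝ} (hr : r ∈ rnRange m Q) (h : |Q| ≤ m) : m < r := by
  have := hr.2 (sq_le_sq' (abs_le.1 h).1 (abs_le.1 h).2)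
  linarith [sqrt_nonneg (m ^ 2 - Q ^ 2)]

theorem two_mul_sq_le_of_abs_le {m Q r : ℝ} (hr : r ∈ rnRange m Q) (h : |Q| ≤ m) :
    2 * Q ^ 2 ≤ 3 * m * r ∧ (0 < m → 2 * Q ^ 2 < 3 * m * r) := by
  have h1 := lt_of_mem_rnRange hr h
  have h2 := sq_le_sq' (abs_le.1 h).1 (abs_le.1 h).2
  have h3 : 0 ≤ m := (abs_nonneg Q).trans h
  exact ⟨by nlinarith, fun hm => by nlinarith⟩

/-- For m ≤ 0 the hypothesis forces Q = 0. For |Q| ≤ m one has r > m ≥ |Q|. For 0 < m < |Q|,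
squaring gives 4Q⁴ ≤ 9m²r² < 9Q²r². Each case is strict, so the area bound is never attained. -/
theorem four_mul_sq_lt {m Q r : ℝ} (hr : r ∈ rnRange m Q) (h : 2 * Q ^ 2 ≤ 3 * m * r) :
    4 * Q ^ 2 < 9 * r ^ 2 := by
  have h0 := hr.1
  rcases le_or_gt m 0 with hm | hm
  · nlinarith [mul_nonneg (neg_nonneg.2 hm) h0.le, pow_pos h0 2]
  · rcases le_or_gt |Q| m with hQ | hQ
    · have h1 := lt_of_mem_rnRange hr hQ
      have h2 := sq_le_sq' (abs_le.1 hQ).1 (abs_le.1 hQ).2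
      nlinarith
    · have h2 : m ^ 2 < Q ^ 2 := by rw [← sq_abs Q]; gcongr
      have hQ2 : 0 < Q ^ 2 := lt_of_le_of_lt (sq_nonneg m) h2
      have h3 : (2 * Q ^ 2) ^ 2 ≤ (3 * m * r) ^ 2 := by gcongr
      have h4 : m ^ 2 * r ^ 2 < Q ^ 2 * r ^ 2 := by gcongr
      nlinarith

theorem sphereArea_rn (m Q r : ℝ) : sphereArea (rnMetric m Q) r = 4 * π * r ^ 2 :=
  sphereArea_sphericalMetric

/-! ### The horizon -/

theorem hasDerivAt_horizonRadius (m Q s : ℝ) :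
    HasDerivAt (horizonRadius m Q) (√(m ^ 2 - Q ^ 2) * sinh s) s :=
  ((hasDerivAt_cosh s).const_mul _).const_add _

theorem contDiff_horizonRadius (m Q : ℝ) : ContDiff ℝ ∞ (horizonRadius m Q) :=
  contDiff_const.add (contDiff_const.mul contDiff_cosh)

theorem sq_sub_sq_pos {m Q : ℝ} (h : |Q| < m) : 0 < m ^ 2 - Q ^ 2 := by
  rw [← sq_abs Q]
  nlinarith [abs_nonneg Q]

theorem isRegularAt_horizon {m Q : ℝ} (h : |Q| < m) :
    IsRegularAt (fun s => horizonRadius m Q s ^ 2) (horizonRadius m Q) 0 := by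
  have hpos : 0 < horizonRadius m Q 0 := by
    have := (abs_nonneg Q).trans_lt h
    rw [horizonRadius, cosh_zero]
    positivity
  exact ⟨Eventually.of_forall fun x => ((contDiff_horizonRadius m Q).pow 2).contDiffAt,
    Eventually.of_forall fun x => (contDiff_horizonRadius m Q).contDiffAt, by positivity, hpos⟩

theorem deriv_horizonRadius (m Q : ℝ) :
    deriv (horizonRadius m Q) = fun s => √(m ^ 2 - Q ^ 2) * sinh s :=
  funext fun s => (hasDerivAt_horizonRadius m Q s).deriv

/-- At s = 0 the derivative R' vanishes, so the horizon is totally geodesic and only the term with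
R'' = √(m² − Q²) > 0 remains; it makes the constant negative. -/
theorem stabilityConst_horizon_lt {m Q : ℝ} (h : |Q| < m) :
    stabilityConst (fun s => horizonRadius m Q s ^ 2) (horizonRadius m Q) 0 < 2 := by
  have hR := (isRegularAt_horizon h).pos_R
  have ha : 0 < √(m ^ 2 - Q ^ 2) := sqrt_pos.2 (sq_sub_sq_pos h)
  have h2 : deriv (deriv (horizonRadius m Q)) 0 = √(m ^ 2 - Q ^ 2) := by
    rw [deriv_horizonRadius, ((hasDerivAt_sinh 0).const_mul _).deriv, cosh_zero, mul_one]
  rw [stabilityConst, h2, deriv_horizonRadius]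
  simp only [sinh_zero, mul_zero, zero_div, add_zero]
  have : horizonRadius m Q 0 ^ 2 * (2 * 0 ^ 2 / (horizonRadius m Q 0 ^ 2 * horizonRadius m Q 0 ^ 2)
      + -2 * √(m ^ 2 - Q ^ 2) / horizonRadius m Q 0 / horizonRadius m Q 0 ^ 2)
      = -(2 * √(m ^ 2 - Q ^ 2) / horizonRadius m Q 0) := by
    field_simp
    ring
  rw [this]
  have : 0 < 2 * √(m ^ 2 - Q ^ 2) / horizonRadius m Q 0 := by positivity
  linarith

theorem bijOn_horizonRadius {m Q : ℝ} (h : |Q| < m) :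
    BijOn (horizonRadius m Q) (Ioi 0) (rnRange m Q) := by
  have hm := (abs_nonneg Q).trans_lt h
  have ha : 0 < √(m ^ 2 - Q ^ 2) := sqrt_pos.2 (sq_sub_sq_pos h)
  refine ⟨?_, ?_, ?_⟩
  · intro s hs
    have h1 : 1 < cosh s := one_lt_cosh.2 (ne_of_gt hs)
    have h2 : m + √(m ^ 2 - Q ^ 2) < horizonRadius m Q s := by
      rw [horizonRadius]; nlinarith
    exact ⟨by linarith, fun _ => h2⟩
  · intro s hs t ht hst
    have h1 : cosh s = cosh t := by
      simpa [horizonRadius, ha.ne'] using hst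
    rw [← abs_of_pos (show 0 < s from hs), ← abs_of_pos (show 0 < t from ht)]
    exact le_antisymm (cosh_le_cosh.1 h1.le) (cosh_le_cosh.1 h1.ge)
  · rintro r ⟨_, hr⟩
    have h1 := hr (by linarith [sq_sub_sq_pos h])
    have h2 : 1 < (r - m) / √(m ^ 2 - Q ^ 2) := by
      rw [one_lt_div ha]; linarith
    obtain ⟨s, hs, he⟩ : ∃ s, 0 < s ∧ cosh s = (r - m) / √(m ^ 2 - Q ^ 2) :=
      ⟨arcosh ((r - m) / √(m ^ 2 - Q ^ 2)), arcosh_pos h2, cosh_arcosh h2.le⟩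
    refine ⟨s, hs, ?_⟩
    rw [horizonRadius, he]
    field_simp
    ring

/-- This identifies f dr² with r(s)² ds², so that off the horizon the two metrics agree under the
change of coordinate. It comes from r² − 2mr + Q² = (r − m)² − (m² − Q²) = (m² − Q²) sinh² s. -/
theorem rnF_mul_deriv_horizonRadius_sq {m Q s : ℝ} (h : |Q| < m) (hs : 0 < s) :
    rnF m Q (horizonRadius m Q s) * deriv (horizonRadius m Q) s ^ 2
      = horizonRadius m Q s ^ 2 := by
  have hr := (bijOn_horizonRadius h).mapsTo hs
  have hpos := rnLapse_pos hr
  have h0 := hr.1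
  rw [rnF, deriv_horizonRadius, inv_mul_eq_iff_eq_mul₀ hpos.ne']
  have e : (1 - 2 * m / horizonRadius m Q s + Q ^ 2 / horizonRadius m Q s ^ 2)
      * horizonRadius m Q s ^ 2
      = horizonRadius m Q s ^ 2 - 2 * m * horizonRadius m Q s + Q ^ 2 := by
    field_simp
  rw [e, horizonRadius]
  have h1 := sq_sqrt (sq_sub_sq_pos h).le
  have h2 := cosh_sq s
  linear_combination (sinh s ^ 2 - cosh s ^ 2) * h1 - (m ^ 2 - Q ^ 2) * h2

/-! ### Asymptotic saturation of the area bound -/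

theorem tendsto_area_rnCritical :
    Tendsto (fun p : ℝ × ℝ =>
        sphereArea (rnMetric p.1 p.2) (rnCritical p.1 p.2) / p.2 ^ 2)
      (comap (fun p : ℝ × ℝ => p.2 ^ 2 / p.1 ^ 2) (𝓝[>] 1) ⊓ 𝓟 {p : ℝ × ℝ | 0 < p.1})
      (𝓝 (16 / 9 * π)) := by
  -- An exact identity; division by zero makes both sides 0 when Q = 0 or m = 0.
  have e : (fun p : ℝ × ℝ => sphereArea (rnMetric p.1 p.2) (rnCritical p.1 p.2) / p.2 ^ 2)
      = fun p => 16 / 9 * π * (p.2 ^ 2 / p.1 ^ 2) := by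
    ext ⟨m, Q⟩
    simp only [sphereArea_rn, rnCritical]
    rcases eq_or_ne Q 0 with rfl | hQ
    · simp
    · rcases eq_or_ne m 0 with rfl | hm
      · simp
      · field_simp
        ring
  rw [e]
  have h1 : Tendsto (fun p : ℝ × ℝ => p.2 ^ 2 / p.1 ^ 2)
      (comap (fun p : ℝ × ℝ => p.2 ^ 2 / p.1 ^ 2) (𝓝[>] 1) ⊓ 𝓟 {p : ℝ × ℝ | 0 < p.1}) (𝓝 1) :=
    (tendsto_comap.mono_left inf_le_left).mono_right nhdsWithin_le_nhds
  simpa using h1.const_mul (16 / 9 * π)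

theorem tendsto_area_rnCritical_of_ne_zero {Q : ℝ} (hQ : Q ≠ 0) :
    Tendsto (fun m : ℝ => sphereArea (rnMetric m Q) (rnCritical m Q))
      (𝓝[<] |Q|) (𝓝 (16 / 9 * π * Q ^ 2)) := by
  have hQ' : |Q| ≠ 0 := abs_ne_zero.2 hQ
  simp only [sphereArea_rn, rnCritical]
  have : ContinuousAt (fun m => 4 * π * (2 * Q ^ 2 / (3 * m)) ^ 2) |Q| := by
    refine continuousAt_const.mul ((continuousAt_const.div (by fun_prop) ?_).pow 2)
    positivity
  have h2 := this.tendsto.mono_left (nhdsWithin_le_nhds (s := Iio |Q|))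
  convert h2 using 2
  have := sq_abs Q
  rw [← this]
  field_simp
  ring

/-- Both ratios are squeezed between 1 and x = 9r²/(4Q²), which tends to 1 by the area hypothesis.
-/
theorem tendsto_of_area_tendsto {m Q r : ℕ → ℝ}
    (h : ∀ n, Q n ≠ 0 ∧ r n ∈ rnRange (m n) (Q n) ∧ 2 * Q n ^ 2 ≤ 3 * m n * r n)
    (hA : Tendsto (fun n => 4 * π * r n ^ 2 / Q n ^ 2) atTop (𝓝 (16 / 9 * π))) :
    (∀ᶠ n in atTop, 0 < m n ∧ m n < |Q n|) ∧
      Tendsto (fun n => Q n ^ 2 / m n ^ 2) atTop (𝓝 1) ∧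
      Tendsto (fun n => r n / rnCritical (m n) (Q n)) atTop (𝓝 1) := by
  have hx : Tendsto (fun n => 9 / 4 * (r n ^ 2 / Q n ^ 2)) atTop (𝓝 1) := by
    have := hA.const_mul (9 / (16 * π))
    convert this using 2
    · field_simp
      ring
    · field_simp
  have hm : ∀ n, 0 < m n := fun n => by
    obtain ⟨hQ, hr, hw⟩ := h n
    have h1 : 0 < 3 * m n * r n := lt_of_lt_of_le (by positivity) hw
    have h2 := pos_of_mul_pos_left h1 hr.1.le
    linarith
  -- If |Q| ≤ m then r > m ≥ |Q|, so x ≥ 9/4, which is excluded once x is close to 1.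
  have hev : ∀ᶠ n in atTop, 0 < m n ∧ m n < |Q n| := by
    filter_upwards [hx.eventually_lt_const (show (1 : ℝ) < 9 / 4 by norm_num)] with n hn
    obtain ⟨hQ, hr, hw⟩ := h n
    refine ⟨hm n, ?_⟩
    by_contra! hle
    have h1 := lt_of_mem_rnRange hr hle
    have h2 := sq_le_sq' (abs_le.1 hle).1 (abs_le.1 hle).2
    have hQ2 : 0 < Q n ^ 2 := by positivity
    have h3 : 1 ≤ r n ^ 2 / Q n ^ 2 := by
      rw [one_le_div hQ2]
      nlinarith [hm n]
    linarith
  refine ⟨hev, ?_, ?_⟩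
  · refine tendsto_of_tendsto_of_tendsto_of_le_of_le' tendsto_const_nhds hx ?_ ?_
    · filter_upwards [hev] with n hn
      rw [one_le_div (pow_pos hn.1 2), ← sq_abs (Q n)]
      exact pow_le_pow_left₀ hn.1.le hn.2.le 2
    · refine Eventually.of_forall fun n => ?_
      -- Squared weak stability 4Q⁴ ≤ 9m²r² is exactly Q²/m² ≤ x.
      obtain ⟨hQ, hr, hw⟩ := h n
      have hm := hm n
      have h3 : (2 * Q n ^ 2) ^ 2 ≤ (3 * m n * r n) ^ 2 := by gcongr
      rw [← mul_div_assoc, div_le_div_iff₀ (by positivity) (by positivity)]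
      nlinarith
  · refine tendsto_of_tendsto_of_tendsto_of_le_of_le' tendsto_const_nhds hx ?_ ?_
    · refine Eventually.of_forall fun n => ?_
      obtain ⟨hQ, hr, hw⟩ := h n
      have hm := hm n
      rw [rnCritical, one_le_div (by positivity), div_le_iff₀ (by positivity)]
      linarith
    · filter_upwards [hev] with n hn
      obtain ⟨hQ, hr, hw⟩ := h n
      have hm := hm n
      have hr0 := hr.1
      have e : r n / rnCritical (m n) (Q n) = 3 * m n * r n / (2 * Q n ^ 2) := by
        rw [rnCritical]; field_simp
      have h1 : 1 ≤ 3 * m n * r n / (2 * Q n ^ 2) := by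
        rw [one_le_div (by positivity)]; exact hw
      have h2 : m n ^ 2 ≤ Q n ^ 2 := by
        rw [← sq_abs (Q n)]
        exact pow_le_pow_left₀ hn.1.le hn.2.le 2
      have h3 : (3 * m n * r n / (2 * Q n ^ 2)) ^ 2
          = 9 / 4 * (r n ^ 2 / Q n ^ 2) * (m n ^ 2 / Q n ^ 2) := by
        field_simp
        norm_num
      have h4 : m n ^ 2 / Q n ^ 2 ≤ 1 := (div_le_one (by positivity)).2 h2
      rw [e]
      -- A ratio that is at least 1 is bounded by its square, and (r/r_c)² = x m²/Q² ≤ x.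
      calc 3 * m n * r n / (2 * Q n ^ 2) ≤ (3 * m n * r n / (2 * Q n ^ 2)) ^ 2 := by nlinarith
        _ = 9 / 4 * (r n ^ 2 / Q n ^ 2) * (m n ^ 2 / Q n ^ 2) := h3
        _ ≤ 9 / 4 * (r n ^ 2 / Q n ^ 2) := mul_le_of_le_one_right (by positivity) h4

end RN

end

/-! ### Classification of the stable spheres and the sharp area bound -/

theorem theorem1 :
    -- all coordinate spheres have constant mean curvature and are isoperimetric,
    -- and `F` is their second variation of area
    (∀ m Q r : ℝ, r ∈ RN.rnRange m Q →
      (∀ y : Fin 2 → ℝ, y 0 ∈ Ioo 0 π →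
        RN.meanCurvature (RN.rnMetric m Q) r y = 2 / (r * √(RN.rnF m Q r))) ∧
      RN.IsIsoperimetric (RN.rnMetric m Q) r ∧
      RN.IsSecondVariation (RN.rnMetric m Q) r) ∧
    -- the case `0 ≤ |Q| ≤ m`
    (∀ m Q r : ℝ, |Q| ≤ m → r ∈ RN.rnRange m Q →
      RN.IsWeaklyStable (RN.rnMetric m Q) r ∧
      (0 < m → RN.IsStable (RN.rnMetric m Q) r)) ∧
    -- the horizon sphere for `|Q| < m`, in a coordinate that is regular there
    (∀ m Q : ℝ, |Q| < m →
      BijOn (RN.horizonRadius m Q) (Ioi 0) (RN.rnRange m Q) ∧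
      (∀ s : ℝ, 0 < s →
        RN.rnF m Q (RN.horizonRadius m Q s) * deriv (RN.horizonRadius m Q) s ^ 2
          = RN.horizonRadius m Q s ^ 2) ∧
      (∀ y : Fin 2 → ℝ, y 0 ∈ Ioo 0 π → RN.meanCurvature (RN.rnHorizonMetric m Q) 0 y = 0) ∧
      RN.IsSecondVariation (RN.rnHorizonMetric m Q) 0 ∧
      RN.IsStable (RN.rnHorizonMetric m Q) 0 ∧
      RN.sphereArea (RN.rnHorizonMetric m Q) 0 = 4 * π * (m + √(m ^ 2 - Q ^ 2)) ^ 2 ∧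
      16 / 9 * π * Q ^ 2 < RN.sphereArea (RN.rnHorizonMetric m Q) 0) ∧
    -- the case `m < 0`
    (∀ m Q r : ℝ, m < 0 → r ∈ RN.rnRange m Q →
      RN.IsIsoperimetric (RN.rnMetric m Q) r ∧ RN.IsUnstable (RN.rnMetric m Q) r) ∧
    -- the case `0 < m < |Q|`
    (∀ m Q r : ℝ, 0 < m → m < |Q| → r ∈ RN.rnRange m Q →
      (RN.IsStable (RN.rnMetric m Q) r ↔ RN.rnCritical m Q < r) ∧
      (RN.IsUnstable (RN.rnMetric m Q) r ↔ r < RN.rnCritical m Q)) ∧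
    -- the area bound for stable (even weakly stable) spheres, and its strictness
    (∀ m Q r : ℝ, r ∈ RN.rnRange m Q → RN.IsWeaklyStable (RN.rnMetric m Q) r →
      16 / 9 * π * Q ^ 2 ≤ RN.sphereArea (RN.rnMetric m Q) r ∧
      RN.sphereArea (RN.rnMetric m Q) r ≠ 16 / 9 * π * Q ^ 2) ∧
    -- the bound is approached by the spheres `r = r_c` as `Q² / m² → 1` from above
    Tendsto (fun p : ℝ × ℝ =>
        RN.sphereArea (RN.rnMetric p.1 p.2) (RN.rnCritical p.1 p.2) / p.2 ^ 2)
      (comap (fun p : ℝ × ℝ => p.2 ^ 2 / p.1 ^ 2) (𝓝[>] 1) ⊓ 𝓟 {p : ℝ × ℝ | 0 < p.1})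
      (𝓝 (16 / 9 * π)) ∧
    (∀ Q : ℝ, Q ≠ 0 →
      Tendsto (fun m : ℝ => RN.sphereArea (RN.rnMetric m Q) (RN.rnCritical m Q))
        (𝓝[<] |Q|) (𝓝 (16 / 9 * π * Q ^ 2))) ∧
    -- and only in this way
    (∀ m Q r : ℕ → ℝ,
      (∀ n, Q n ≠ 0 ∧ r n ∈ RN.rnRange (m n) (Q n) ∧
        RN.IsWeaklyStable (RN.rnMetric (m n) (Q n)) (r n)) →
      Tendsto (fun n => RN.sphereArea (RN.rnMetric (m n) (Q n)) (r n) / Q n ^ 2) atTop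
        (𝓝 (16 / 9 * π)) →
      (∀ᶠ n in atTop, 0 < m n ∧ m n < |Q n|) ∧
      Tendsto (fun n => Q n ^ 2 / m n ^ 2) atTop (𝓝 1) ∧
      Tendsto (fun n => r n / RN.rnCritical (m n) (Q n)) atTop (𝓝 1)) := by
  refine ⟨?_, ?_, ?_, ?_, ?_, ?_, RN.tendsto_area_rnCritical,
    fun Q hQ => RN.tendsto_area_rnCritical_of_ne_zero hQ, ?_⟩
  · intro m Q r hr
    have hreg := RN.isRegularAt_rn hr
    refine ⟨fun y hy => ?_, RN.isIsoperimetric_rn hr, RN.isSecondVariation_sphericalMetric hreg⟩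
    rw [RN.rnMetric, RN.meanCurvature_sphericalMetric hreg (sin_pos_of_mem_Ioo hy).ne']
    simp
  · intro m Q r hQ hr
    rw [RN.isWeaklyStable_rn_iff hr, RN.isStable_rn_iff hr]
    exact RN.two_mul_sq_le_of_abs_le hr hQ
  · intro m Q hQ
    have hreg := RN.isRegularAt_horizon hQ
    have hm := (abs_nonneg Q).trans_lt hQ
    have harea : RN.sphereArea (RN.rnHorizonMetric m Q) 0
        = 4 * π * (m + √(m ^ 2 - Q ^ 2)) ^ 2 := by
      rw [RN.rnHorizonMetric, RN.sphereArea_sphericalMetric, RN.horizonRadius, cosh_zero, mul_one]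
    refine ⟨RN.bijOn_horizonRadius hQ, fun s hs => RN.rnF_mul_deriv_horizonRadius_sq hQ hs,
      fun y hy => ?_, RN.isSecondVariation_sphericalMetric hreg,
      (RN.isStable_iff hreg (RN.isIsoperimetric_sphericalMetric hreg)).2
        (RN.stabilityConst_horizon_lt hQ), harea, ?_⟩
    · rw [RN.rnHorizonMetric, RN.meanCurvature_sphericalMetric hreg (sin_pos_of_mem_Ioo hy).ne',
        RN.deriv_horizonRadius]
      simp
    · rw [harea]
      have h1 := RN.sq_sub_sq_pos hQ
      have h2 := sqrt_nonneg (m ^ 2 - Q ^ 2)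
      have h3 : 4 / 9 * Q ^ 2 < (m + √(m ^ 2 - Q ^ 2)) ^ 2 := by nlinarith [sq_nonneg Q]
      nlinarith [pi_pos]
  · intro m Q r hm hr
    rw [RN.isUnstable_rn_iff hr]
    exact ⟨RN.isIsoperimetric_rn hr, by nlinarith [mul_pos (neg_pos.2 hm) hr.1, sq_nonneg Q]⟩
  · intro m Q r hm _ hr
    rw [RN.isStable_rn_iff hr, RN.isUnstable_rn_iff hr, RN.rnCritical, div_lt_iff₀ (by positivity),
      lt_div_iff₀ (by positivity), mul_comm r]
    exact ⟨Iff.rfl, Iff.rfl⟩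
  · intro m Q r hr hw
    have h1 := RN.four_mul_sq_lt hr ((RN.isWeaklyStable_rn_iff hr).1 hw)
    have h2 : 16 / 9 * π * Q ^ 2 < RN.sphereArea (RN.rnMetric m Q) r := by
      rw [RN.sphereArea_rn]
      nlinarith [pi_pos]
    exact ⟨h2.le, h2.ne'⟩
  · intro m Q r h hA
    simp only [RN.sphereArea_rn] at hA
    exact RN.tendsto_of_area_tendsto
      (fun n => ⟨(h n).1, (h n).2.1, (RN.isWeaklyStable_rn_iff (h n).2.1).1 (h n).2.2⟩) hA
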